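/- Let $1\le k\le 6$. The BDF$k$ method with step $h>0$ for $y'=f(t,y)$ on the grid $t_n=t_0+nh$ is $\sum_{m=1}^{k}\frac1m\nabla^m y_{n+k}=h\,f(t_{n+k},y_{n+k})$, where $\nabla$ is the backward difference; write it as $\sum_{j=0}^k\alpha_j y_{n+j}=h\sum_{j=0}^k\beta_j f(t_{n+j},y_{n+j})$. The BDF$k$-GRE method (global Richardson extrapolation) forms $$r_n(h)=\frac{2^k}{2^k-1}\,y_{2n}\!\left(\tfrac h2\right)-\frac{1}{2^k-1}\,y_n(h)$$ from two BDF$k$ sequences computed independently with steps $h$ and $h/2$. **(1) Convergence.** Let $y$ solve $y'=f(t,y)$ on $[t_0,T]$, $t_0<T$, in $\mathbb R^d$, where $f$ is of class $C^{k+1}$ on an open set $D\subseteq\mathbb R\times\mathbb R^d$ containing the graph of $y$. (a) There is a closed tube $\{(t,u): t\in[t_0,T],\ \|u-y(t)\|\le\rho\}\subseteq D$, $\rho>0$, on which $f$ is Lipschitz in $u$ uniformly in $t$, such that for each $M$ and all sufficiently small $h>0$ (depending on $M$): for any starting values $y_0,\dots,y_{k-1}$ with $\|y_j-y(t_j)\|\le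 Mh^{k+1}$ there is exactly one BDF$k$ sequence on the grid points in $[t_0,T]$ with these starting values that stays in the tube. (b) Let $K\subseteq D$ contain the graph of $y$, and let $f$ be Lipschitz in $u$ on $K$ uniformly in $t$. For each $M$ there are $h_0>0$ and $C$ such that for $0<h<h_0$, if $y_n(h)$ and $y_m(h/2)$ are BDF$k$ sequences on their grids in $[t_0,T]$ with points in $K$, whose starting values ($0\le j\le k-1$) differ from the exact solution values by at most $Mh^{k+1}$, then $\|r_n(h)-y(t_n)\|\le C h^{k+1}$ for all $n$ with $t_n=t_0+nh\in[t_0,T]$. That is, BDF$k$-GRE with $(k+1)$-st order accurate starting values converges with order $k+1$. **(2) Stability angle.** Apply the methods to $y'=\lambda y$, $\lambda\in\mathbb C$, and put $\mu=h\lambda$. Let $\mathcal S_{\mathrm{BDF}k}$ be the set of $\mu\in\mathbb C$ with $\alpha_k-\mu\beta_k\ne0$ for which $(y_n)_{n\in\mathbb N}$ is bounded for all starting values, and $\mathcal S_{\mathrm{GRE}}$ the set of $\mu\in\mathbb C$ with $\alpha_k-\mu\beta_k\ne0$ and $\alpha_k-\frac\mu2\beta_k\neq0$ for which $(r_n(h))_{n\in\mathbb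 N}$ is bounded for all starting values of both sequences. For $0<\theta\le\pi/2$, a method is $A(\theta)$-stable if its region contains $\{\mu\ne0:|\arg(-\mu)|<\theta\}$. Then BDF$k$-GRE is $A(\theta)$-stable if and only if BDF$k$ is; hence both have the same $A(\alpha)$-stability angle, the largest such $\theta$ (or $0$ if there is none). **(3)** In particular, BDF2-GRE is a third-order $A$-stable method: it converges with order $3$ in the sense of (1), and its stability region contains $\{\mu:\operatorname{Re}\mu\le0\}$. -/

import Mathlib

open Finset

/-- The coefficients of a linear multistep method with `k` steps,
`∑_{j=0}^k α_j y_{n+j} = ∑_{j=0}^k h β_j f(t_{n+j}, y_{n+j})`.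
Only the values `α j`, `β j` with `j ≤ k` matter. -/
structure LMM where
  k : ℕ
  α : ℕ → ℝ
  β : ℕ → ℝ

/-- The `k`-step BDF method `∑_{m=1}^k (1/m) ∇^m y_{n+k} = h f(t_{n+k}, y_{n+k})`, where `∇` is the
backward difference, so that the coefficient of `y_{n+j} = y_{(n+k)-(k-j)}` in `∇^m y_{n+k}` is
`(-1)^(k-j) * choose m (k-j)`. -/
noncomputable def BDF (k : ℕ) : LMM where
  k := k
  α := fun j => ∑ m ∈ Icc 1 k, (1 / (m : ℝ)) * ((-1) ^ (k - j) * (m.choose (k - j) : ℝ))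
  β := fun j => if j = k then 1 else 0

/-- The leading coefficient `α_k` of a BDF method is positive. -/
theorem BDF_leading_pos (k : ℕ) (hk : 1 ≤ k) : 0 < (BDF k).α (BDF k).k := by
  simp only [BDF, Nat.sub_self, pow_zero, Nat.choose_zero_right, Nat.cast_one, mul_one]
  refine Finset.sum_pos (fun m hm => ?_) ⟨1, by simp [hk]⟩
  have : 0 < m := (Finset.mem_Icc.1 hm).1
  positivity

/-- The Richardson combination
`r_n = 2^p / (2^p - 1) * z_{2n} - 1 / (2^p - 1) * y_n`, where `Y` is the sequence on the coarse grid
(step `h`) and `Z` the sequence on the fine grid (step `h / 2`). -/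
noncomputable def greSeq {E : Type*} [AddCommGroup E] [Module ℝ E] (p : ℕ) (Y Z : ℕ → E) (n : ℕ) :
    E :=
  ((2 : ℝ) ^ p / ((2 : ℝ) ^ p - 1)) • Z (2 * n) - (1 / ((2 : ℝ) ^ p - 1)) • Y n

/-- The relation of the method at index `n`, for `y' = f(t, y)` on the grid `t_n = t₀ + n h`. -/
def LMM.Step {E : Type*} [AddCommGroup E] [Module ℝ E] (m : LMM) (f : ℝ → E → E) (t₀ h : ℝ)
    (Y : ℕ → E) (n : ℕ) : Prop :=
  ∑ j ∈ range (m.k + 1), m.α j • Y (n + j) =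
    ∑ j ∈ range (m.k + 1), (h * m.β j) • f (t₀ + ((n + j : ℕ) : ℝ) * h) (Y (n + j))

/-! ### Convergence -/

/-- `Y` is produced by the method with step `h` on the part of the grid inside `[t₀, T]`, and its
points `(t_n, Y n)` lie in the region `K`. (The values of `Y` beyond `T` are irrelevant.) -/
structure LMM.IsNumericalSolution {E : Type*} [AddCommGroup E] [Module ℝ E] (m : LMM)
    (f : ℝ → E → E) (t₀ T h : ℝ) (K : Set (ℝ × E)) (Y : ℕ → E) : Prop where
  step : ∀ n : ℕ, t₀ + ((n + m.k : ℕ) : ℝ) * h ≤ T → m.Step f t₀ h Y n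
  mem : ∀ n : ℕ, t₀ + (n : ℝ) * h ≤ T → (t₀ + (n : ℝ) * h, Y n) ∈ K

/-- The first `k` values of `Y` on the grid of step `h` differ from `y` by at most `ε`. -/
def StartWithin {E : Type*} [NormedAddCommGroup E] (k : ℕ) (y : ℝ → E) (t₀ h ε : ℝ)
    (Y : ℕ → E) : Prop :=
  ∀ j < k, ‖Y j - y (t₀ + (j : ℝ) * h)‖ ≤ ε

/-- `f` is Lipschitz in its second argument on `K`, uniformly in the first one. -/
def LipschitzInState {E : Type*} [NormedAddCommGroup E] (f : ℝ → E → E) (K : Set (ℝ × E)) : Prop :=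
  ∃ L : ℝ, ∀ (t : ℝ) (u v : E), (t, u) ∈ K → (t, v) ∈ K → ‖f t u - f t v‖ ≤ L * ‖u - v‖

/-- `y` solves `y' = f(t, y)` on `[t₀, T]`, with one-sided derivatives at the end points. -/
def IsODESolution {E : Type*} [NormedAddCommGroup E] [NormedSpace ℝ E] (f : ℝ → E → E)
    (t₀ T : ℝ) (y : ℝ → E) : Prop :=
  ∀ t ∈ Set.Icc t₀ T, HasDerivWithinAt y (f t (y t)) (Set.Icc t₀ T) t

/-- The closed tube of radius `ρ` around the graph of `y` over `[t₀, T]`. -/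
def tube {E : Type*} [NormedAddCommGroup E] (y : ℝ → E) (t₀ T ρ : ℝ) : Set (ℝ × E) :=
  {x | x.1 ∈ Set.Icc t₀ T ∧ ‖x.2 - y x.1‖ ≤ ρ}

/-- For the problem `y' = f(t, y)` with solution `y` on `[t₀, T]`, the (possibly implicit) method is
locally well-posed for starting values with an error `O(h ^ q)`: in some tube around the graph of `y`,
contained in `D`, on which `f` is Lipschitz in the state, the numerical solution exists
and is unique for all small `h`. -/
def LMM.WellPosedNear {E : Type*} [NormedAddCommGroup E] [NormedSpace ℝ E] (m : LMM) (q : ℕ)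
    (f : ℝ → E → E) (D : Set (ℝ × E)) (t₀ T : ℝ) (y : ℝ → E) : Prop :=
  ∃ ρ > (0 : ℝ), tube y t₀ T ρ ⊆ D ∧ LipschitzInState f (tube y t₀ T ρ) ∧
    ∀ M : ℝ, ∃ h₀ > (0 : ℝ), ∀ h : ℝ, 0 < h → h < h₀ →
      ∀ s : ℕ → E, StartWithin m.k y t₀ h (M * h ^ q) s →
        (∃ Y : ℕ → E, m.IsNumericalSolution f t₀ T h (tube y t₀ T ρ) Y ∧ ∀ j < m.k, Y j = s j) ∧
        ∀ Y Y' : ℕ → E,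
          m.IsNumericalSolution f t₀ T h (tube y t₀ T ρ) Y → (∀ j < m.k, Y j = s j) →
          m.IsNumericalSolution f t₀ T h (tube y t₀ T ρ) Y' → (∀ j < m.k, Y' j = s j) →
          ∀ n : ℕ, t₀ + (n : ℝ) * h ≤ T → Y n = Y' n

/-- For the problem `y' = f(t, y)` with solution `y` on `[t₀, T]`, the extrapolated sequence is
`O(h ^ q)`-close to `y` on `[t₀, T]` when the starting values of both sequences are. The
numerical solutions are those in a region `K` that contains the graph of `y` and on which `f` is
Lipschitz in the state; `K` is arbitrary otherwise. -/
def LMM.GREError {E : Type*} [NormedAddCommGroup E] [NormedSpace ℝ E] (m : LMM) (p q : ℕ)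
    (f : ℝ → E → E) (D : Set (ℝ × E)) (t₀ T : ℝ) (y : ℝ → E) : Prop :=
  ∀ K : Set (ℝ × E), K ⊆ D → (∀ t ∈ Set.Icc t₀ T, (t, y t) ∈ K) → LipschitzInState f K →
    ∀ M : ℝ, ∃ h₀ > (0 : ℝ), ∃ C : ℝ, ∀ h : ℝ, 0 < h → h < h₀ →
      ∀ Y Z : ℕ → E,
        m.IsNumericalSolution f t₀ T h K Y → StartWithin m.k y t₀ h (M * h ^ q) Y →
        m.IsNumericalSolution f t₀ T (h / 2) K Z → StartWithin m.k y t₀ (h / 2) (M * h ^ q) Z →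
        ∀ n : ℕ, t₀ + (n : ℝ) * h ≤ T → ‖greSeq p Y Z n - y (t₀ + (n : ℝ) * h)‖ ≤ C * h ^ q

/-- The extrapolated method (with weights for the order `p`) converges with order `q` whenever the
starting values are accurate of order `q`: for every system `y' = f(t, y)` with a right-hand side of
class `C^q` on an open set `D` that contains the graph of the solution `y` over `[t₀, T]`, the
sequences exist locally and the extrapolated sequence has error `O(h ^ q)`. -/
def LMM.GREConvergesWithOrder (m : LMM) (p q : ℕ) : Prop :=
  ∀ (d : ℕ) (f : ℝ → EuclideanSpace ℝ (Fin d) → EuclideanSpace ℝ (Fin d))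
    (D : Set (ℝ × EuclideanSpace ℝ (Fin d))) (t₀ T : ℝ) (y : ℝ → EuclideanSpace ℝ (Fin d)),
    t₀ < T → IsOpen D → ContDiffOn ℝ q (fun x : ℝ × EuclideanSpace ℝ (Fin d) => f x.1 x.2) D →
    IsODESolution f t₀ T y → (∀ t ∈ Set.Icc t₀ T, (t, y t) ∈ D) →
    m.WellPosedNear q f D t₀ T y ∧ m.GREError p q f D t₀ T y

/-! ### Linear stability -/

/-- The recursion of the method for the test equation `y' = λ y` with step `h`, where `μ = h λ`. -/
def LMM.TestRecursion (m : LMM) (μ : ℂ) (Y : ℕ → ℂ) : Prop :=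
  ∀ n : ℕ, ∑ j ∈ range (m.k + 1), (m.α j : ℂ) * Y (n + j) =
    μ * ∑ j ∈ range (m.k + 1), (m.β j : ℂ) * Y (n + j)

/-- `LMM.TestRecursion` is the method itself, applied to the test equation. -/
theorem LMM.testRecursion_iff (m : LMM) (t₀ h : ℝ) (l : ℂ) (Y : ℕ → ℂ) :
    m.TestRecursion (h * l) Y ↔ ∀ n, m.Step (fun _ u => l * u) t₀ h Y n := by
  refine forall_congr' fun n => ?_
  simp only [LMM.Step, Complex.real_smul, Finset.mul_sum]
  have e : ∀ j, (h : ℂ) * l * ((m.β j : ℂ) * Y (n + j)) =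
      ((h * m.β j : ℝ) : ℂ) * (l * Y (n + j)) := by
    intro j; push_cast; ring
  simp only [e]

/-- The region of absolute stability of a linear multistep method. -/
def LMM.stabilityRegion (m : LMM) : Set ℂ :=
  {μ | (m.α m.k : ℂ) - μ * (m.β m.k : ℂ) ≠ 0 ∧
    ∀ Y : ℕ → ℂ, m.TestRecursion μ Y → ∃ C : ℝ, ∀ n, ‖Y n‖ ≤ C}

/-- The region of absolute stability of the extrapolated method with weights for the order `p`. -/
def LMM.greStabilityRegion (m : LMM) (p : ℕ) : Set ℂ :=
  {μ | (m.α m.k : ℂ) - μ * (m.β m.k : ℂ) ≠ 0 ∧ (m.α m.k : ℂ) - μ / 2 * (m.β m.k : ℂ) ≠ 0 ∧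
    ∀ Y Z : ℕ → ℂ, m.TestRecursion μ Y → m.TestRecursion (μ / 2) Z →
      ∃ C : ℝ, ∀ n, ‖greSeq p Y Z n‖ ≤ C}

/-- `A(θ)`-stability: the stability region contains the sector `{μ ≠ 0 : |arg (-μ)| < θ}`. -/
def IsAThetaStable (S : Set ℂ) (θ : ℝ) : Prop :=
  {μ : ℂ | μ ≠ 0 ∧ |(-μ).arg| < θ} ⊆ S

/-- `A`-stability: the stability region contains the closed left half-plane. -/
def IsAStable (S : Set ℂ) : Prop := {μ : ℂ | μ.re ≤ 0} ⊆ S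

/-- The stability angle: the largest `θ ∈ [0, π/2]` with `A(θ)`-stability. (The set contains `0`,
is bounded, and contains its supremum.) -/
noncomputable def stabilityAngle (S : Set ℂ) : ℝ :=
  sSup {θ : ℝ | 0 ≤ θ ∧ θ ≤ Real.pi / 2 ∧ IsAThetaStable S θ}

/-! Extrapolation gains an order because the global error of BDF`k` has an expansion `Y n = y(t_n) +
h^k e(t_n) + O(h^(k+1))` with one function `e` for all step sizes (`BDF_error_expansion`). The
Richardson weights have difference one and cancel the `h^k` terms of the steps `h` and `h / 2`
(`BDF_greError`).

Here `e` solves the linearised equation `e' = f_u(t, y) e - c y^(k+1)`, `e(t₀) = 0`, with `y^(k+1)`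
the derivative of that order and `c` the error constant. The sequence `w = Y - y - h^k e` has BDF
residual `h f_u w + O(h^(k+2))`: Taylor's formula gives the defects of `y` and `e`, and the
nonlinear remainder is `O(‖Y - y‖²) = O(h^(2k))` by convergence of order `k` (`BDF_error_le`).
Zero-stability and a discrete Gronwall inequality then give `w = O(h^(k+1))`.

Zero-stability for `k ≤ 6` needs no location of roots. Let `ρ(z) = ∑ α_j z^j = (z - 1) σ(z)`. For
each `k` there is a multiple `q σ = z^J - r` with `deg r < J` and `∑ |r_j| < 1`, and this bounds the
sum of the norms of the differences `w (n + 1) - w n`.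

For well-posedness, `f` is extended from a tube to a globally Lipschitz function; the implicit steps
are then contractions, and the error estimate keeps the sequence in the tube.

For the stability angle, a zero fine sequence shows that the extrapolated region lies in the BDF
region. Conversely a sector contains `μ / 2` along with `μ`. For BDF2 a quadratic Lyapunov function
proves `A`-stability. -/

/-! ### Zero-stability -/

/-- Zero-stability with constant `S`: a sequence is bounded by its first `k` values and the sum of
the residuals of the homogeneous recursion with coefficients `α`. -/
def ZeroStableWith (E : Type*) [NormedAddCommGroup E] [NormedSpace ℝ E] (k : ℕ) (α : ℕ → ℝ)
    (S : ℝ) : Prop :=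
  ∀ (w : ℕ → E) (ε δ : ℝ) (n : ℕ), (∀ j < k, ‖w j‖ ≤ ε) →
    ∑ i ∈ range n, ‖∑ j ∈ range (k + 1), α j • w (i + j)‖ ≤ δ →
    ∀ m < n + k, ‖w m‖ ≤ S * (ε + δ)

section ZeroStability

variable {E : Type*} [NormedAddCommGroup E] [NormedSpace ℝ E]

/-- Over a bounded number of steps, a recursion with non-zero leading coefficient is stable. -/
theorem exists_bound_of_lt {k : ℕ} (hk : 1 ≤ k) {α : ℕ → ℝ} (hα : α k ≠ 0) (J : ℕ) :
    ∃ G : ℝ, 0 ≤ G ∧ ∀ (w : ℕ → E) (ε δ : ℝ) (n : ℕ), (∀ j < k, ‖w j‖ ≤ ε) →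
      ∑ i ∈ range n, ‖∑ j ∈ range (k + 1), α j • w (i + j)‖ ≤ δ →
      ∀ m < n + k, m < J → ‖w m‖ ≤ G * (ε + δ) := by
  induction J with
  | zero => exact ⟨0, le_rfl, fun _ _ _ _ _ _ m _ hm => absurd hm (by omega)⟩
  | succ J ih =>
    obtain ⟨G, hG, h⟩ := ih
    -- The three entries serve the indices below `J`, the starting values, and the value at `J`
    -- obtained by solving its residual for the leading term.
    refine ⟨max (max G 1) (|α k|⁻¹ * (1 + (∑ j ∈ range k, |α j|) * G)), by positivity, ?_⟩
    intro w ε δ n hε hδ m hm hmJ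
    have ε0 : 0 ≤ ε := (norm_nonneg _).trans (hε 0 hk)
    have δ0 : 0 ≤ δ := (sum_nonneg fun _ _ => norm_nonneg _).trans hδ
    have hs : 0 ≤ ε + δ := add_nonneg ε0 δ0
    rcases Nat.lt_succ_iff_lt_or_eq.1 hmJ with hlt | rfl
    · exact (h w ε δ n hε hδ m hm hlt).trans
        (mul_le_mul_of_nonneg_right ((le_max_left _ _).trans (le_max_left _ _)) hs)
    by_cases hmk : m < k
    · calc ‖w m‖ ≤ 1 * (ε + δ) := by linarith [hε m hmk]
        _ ≤ _ := mul_le_mul_of_nonneg_right ((le_max_right _ _).trans (le_max_left _ _)) hs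
    obtain ⟨i, rfl⟩ : ∃ i, m = i + k := ⟨m - k, by omega⟩
    have hi : i < n := by omega
    have hres : ‖∑ j ∈ range (k + 1), α j • w (i + j)‖ ≤ δ :=
      (single_le_sum (f := fun i => ‖∑ j ∈ range (k + 1), α j • w (i + j)‖)
        (fun _ _ => norm_nonneg _) (mem_range.2 hi)).trans hδ
    have hlow : ‖∑ j ∈ range k, α j • w (i + j)‖ ≤ (∑ j ∈ range k, |α j|) * G * (ε + δ) := by
      refine (norm_sum_le _ _).trans ?_
      rw [sum_mul, sum_mul]
      refine sum_le_sum fun j hj => ?_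
      have hj := mem_range.1 hj
      rw [norm_smul, Real.norm_eq_abs, mul_assoc]
      exact mul_le_mul_of_nonneg_left (h w ε δ n hε hδ _ (by omega) (by omega)) (abs_nonneg _)
    have hw : w (i + k) = (α k)⁻¹ •
        (∑ j ∈ range (k + 1), α j • w (i + j) - ∑ j ∈ range k, α j • w (i + j)) := by
      rw [sum_range_succ, add_sub_cancel_left, inv_smul_smul₀ hα]
    calc ‖w (i + k)‖ ≤ |α k|⁻¹ * (δ + (∑ j ∈ range k, |α j|) * G * (ε + δ)) := by
          rw [hw, norm_smul, norm_inv, Real.norm_eq_abs]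
          exact mul_le_mul_of_nonneg_left ((norm_sub_le _ _).trans (add_le_add hres hlow))
            (by positivity)
      _ ≤ |α k|⁻¹ * (1 + (∑ j ∈ range k, |α j|) * G) * (ε + δ) := by
          rw [mul_assoc |α k|⁻¹]
          exact mul_le_mul_of_nonneg_left (by linarith) (by positivity)
      _ ≤ _ := mul_le_mul_of_nonneg_right (le_max_right _ _) hs

/-- If the differences `w (n + 1) - w n` satisfy, up to a combination of residuals, a recursion
whose coefficients have absolute sum less than one, then the method is zero-stable. -/
theorem exists_zeroStableWith {k J : ℕ} (hk : 1 ≤ k) (hJ : k ≤ J + 1) {α q r : ℕ → ℝ}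
    (hα : α k ≠ 0) (hr : ∑ j ∈ range J, |r j| < 1)
    (hqr : ∀ (w : ℕ → E) (n : ℕ), w (n + J + 1) - w (n + J) =
      ∑ i ∈ range (J + 2 - k), q i • ∑ j ∈ range (k + 1), α j • w (n + i + j) +
        ∑ j ∈ range J, r j • (w (n + j + 1) - w (n + j))) :
    ∃ S : ℝ, 0 ≤ S ∧ ZeroStableWith E k α S := by
  -- In terms of the shift `z`, `hqr` reads `z^J (z - 1) = q(z) ρ(z) + r(z) (z - 1)`. Summing norms
  -- over `n`, the total variation of `w` reappears on the right with the factor `R < 1` and is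
  -- absorbed. The first `J` differences involve `w 0, ..., w J`, hence `J + 1`.
  obtain ⟨G, hG, h⟩ := exists_bound_of_lt (E := E) hk hα (J + 1)
  set Q := ∑ i ∈ range (J + 2 - k), |q i|
  set R := ∑ j ∈ range J, |r j|
  have hQ : 0 ≤ Q := sum_nonneg fun _ _ => abs_nonneg _
  have hR : 0 < 1 - R := sub_pos.2 hr
  refine ⟨1 + (J * (2 * G) + Q) / (1 - R), by positivity, ?_⟩
  intro w ε δ n hε hδ
  have ε0 : 0 ≤ ε := (norm_nonneg _).trans (hε 0 hk)
  have δ0 : 0 ≤ δ := (sum_nonneg fun _ _ => norm_nonneg _).trans hδ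
  have hs : 0 ≤ ε + δ := add_nonneg ε0 δ0
  set v : ℕ → E := fun m => w (m + 1) - w m with hv
  have hsmall : ∀ m, m + 1 < n + k → m < J → ‖v m‖ ≤ 2 * G * (ε + δ) := fun m hm hmJ =>
    (norm_sub_le _ _).trans (by
      linarith [h w ε δ n hε hδ (m + 1) hm (by omega), h w ε δ n hε hδ m (by omega) (by omega)])
  have hV : ∀ N, N < n + k →
      ∑ m ∈ range N, ‖v m‖ ≤ (J * (2 * G) + Q) / (1 - R) * (ε + δ) := by
    intro N hN
    have hinit : ∀ M ≤ J, M ≤ N → ∑ m ∈ range M, ‖v m‖ ≤ J * (2 * G) * (ε + δ) := by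
      intro M hM hMN
      calc ∑ m ∈ range M, ‖v m‖ ≤ ∑ m ∈ range M, 2 * G * (ε + δ) :=
            sum_le_sum fun m hm => hsmall m (by have := mem_range.1 hm; omega)
              (by have := mem_range.1 hm; omega)
        _ = M * (2 * G * (ε + δ)) := by simp
        _ ≤ J * (2 * G * (ε + δ)) :=
            mul_le_mul_of_nonneg_right (by exact_mod_cast hM) (by positivity)
        _ = _ := by ring
    have hkey : ∑ m ∈ range N, ‖v m‖ ≤
        J * (2 * G) * (ε + δ) + Q * δ + R * ∑ m ∈ range N, ‖v m‖ := by
      have hRV : 0 ≤ R * ∑ m ∈ range N, ‖v m‖ :=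
        mul_nonneg (sum_nonneg fun _ _ => abs_nonneg _) (sum_nonneg fun _ _ => norm_nonneg _)
      rcases le_total N J with hNJ | hNJ
      · linarith [hinit N hNJ le_rfl, mul_nonneg hQ δ0]
      obtain ⟨P, rfl⟩ : ∃ P, N = J + P := ⟨N - J, by omega⟩
      have hp : ∀ p ∈ range P, ‖v (J + p)‖ ≤
          ∑ i ∈ range (J + 2 - k), |q i| * ‖∑ j ∈ range (k + 1), α j • w (p + i + j)‖ +
            ∑ j ∈ range J, |r j| * ‖v (p + j)‖ := by
        intro p _
        rw [add_comm J p, show v (p + J) = w (p + J + 1) - w (p + J) from rfl, hqr w p]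
        refine (norm_add_le _ _).trans (add_le_add ?_ ?_) <;>
        · refine (norm_sum_le _ _).trans (sum_le_sum fun i _ => ?_)
          rw [norm_smul, Real.norm_eq_abs]
      have hshift : ∀ (g : ℕ → ℝ) (i N' : ℕ), (∀ m, 0 ≤ g m) → P + i ≤ N' →
          ∑ p ∈ range P, g (p + i) ≤ ∑ m ∈ range N', g m := by
        intro g i N' hg hN'
        calc ∑ p ∈ range P, g (p + i) ≤ ∑ m ∈ range i, g m + ∑ p ∈ range P, g (i + p) := by
              simp only [add_comm i]
              exact le_add_of_nonneg_left (sum_nonneg fun _ _ => hg _)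
          _ = ∑ m ∈ range (i + P), g m := (sum_range_add _ _ _).symm
          _ ≤ _ := sum_le_sum_of_subset_of_nonneg
              (range_subset_range.2 (by omega)) fun _ _ _ => hg _
      rw [sum_range_add]
      rw [add_assoc]
      refine add_le_add (hinit J le_rfl hNJ) ((sum_le_sum hp).trans ?_)
      rw [sum_add_distrib, sum_comm, sum_comm (s := range P) (t := range J), ← sum_range_add]
      refine add_le_add ?_ ?_
      · rw [sum_mul]
        refine sum_le_sum fun i hi => ?_
        rw [← mul_sum]
        have hi := mem_range.1 hi
        -- `J + P < n + k` and `i < J + 2 - k` give `P + i ≤ n`, so only residuals counted in `δ`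
        -- occur.
        exact mul_le_mul_of_nonneg_left
          ((hshift (fun m => ‖∑ j ∈ range (k + 1), α j • w (m + j)‖) i n
            (fun _ => norm_nonneg _) (by omega)).trans hδ) (abs_nonneg _)
      · rw [sum_mul]
        refine sum_le_sum fun j hj => ?_
        rw [← mul_sum]
        have hj := mem_range.1 hj
        exact mul_le_mul_of_nonneg_left
          (hshift (fun m => ‖v m‖) j (J + P) (fun _ => norm_nonneg _) (by omega)) (abs_nonneg _)
    rw [div_mul_eq_mul_div, le_div_iff₀ hR]
    nlinarith [mul_nonneg hQ ε0]
  intro m hm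
  have hw : w m = w 0 + ∑ i ∈ range m, v i := by rw [hv, sum_range_sub]; abel
  rw [hw]
  refine (norm_add_le _ _).trans ?_
  have := (norm_sum_le _ _).trans (hV m hm)
  linarith [hε 0 hk]

/-- The discrete Gronwall inequality for a zero-stable recursion. -/
theorem ZeroStableWith.norm_le {k : ℕ} {α : ℕ → ℝ} {S : ℝ} (hS : ZeroStableWith E k α S)
    (hk : 1 ≤ k) (S0 : 0 ≤ S) {w : ℕ → E} {ε η c : ℝ} {n : ℕ} (hc : 0 ≤ c) (hη : 0 ≤ η)
    (hSc : S * c ≤ 1 / 2) (hε : ∀ j < k, ‖w j‖ ≤ ε)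
    (hw : ∀ i < n, ‖∑ j ∈ range (k + 1), α j • w (i + j)‖ ≤ c * ‖w (i + k)‖ + η) :
    ∀ m < n + k, ‖w m‖ ≤ 2 * S * (ε + n * η) * Real.exp (2 * S * (n * c)) := by
  have ε0 : 0 ≤ ε := (norm_nonneg _).trans (hε 0 hk)
  set B := S * (ε + n * η) with hB
  have B0 : 0 ≤ B := by positivity
  -- The bound on the residual at `i` contains the newest value `w (i + k)`. Since `S * c ≤ 1 / 2`,
  -- that term moves to the left at the cost of a factor 2.
  have hstep : ∀ i < n, ‖w (i + k)‖ ≤ 2 * B + 2 * S * c * ∑ l ∈ range i, ‖w (l + k)‖ := by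
    intro i hi
    have h1 := hS w ε _ (i + 1) hε le_rfl (i + k) (by omega)
    have h2 : ∑ l ∈ range (i + 1), ‖∑ j ∈ range (k + 1), α j • w (l + j)‖ ≤
        c * (∑ l ∈ range i, ‖w (l + k)‖ + ‖w (i + k)‖) + n * η := by
      calc _ ≤ ∑ l ∈ range (i + 1), (c * ‖w (l + k)‖ + η) :=
            sum_le_sum fun l hl => hw l (by have := mem_range.1 hl; omega)
        _ = c * (∑ l ∈ range i, ‖w (l + k)‖ + ‖w (i + k)‖) + ((i + 1 : ℕ) : ℝ) * η := by
            rw [sum_add_distrib, ← mul_sum, sum_range_succ]; simp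
        _ ≤ _ := by
            have : ((i + 1 : ℕ) : ℝ) ≤ n := by exact_mod_cast hi
            gcongr
    have h3 := h1.trans (mul_le_mul_of_nonneg_left (add_le_add_right h2 ε) S0)
    have h4 := mul_le_mul_of_nonneg_right hSc (norm_nonneg (w (i + k)))
    rw [hB]
    linarith
  have hpow : ∀ i, i < n → ‖w (i + k)‖ ≤ 2 * B * (1 + 2 * S * c) ^ i := by
    intro i
    induction i using Nat.strong_induction_on with
    | _ i ih =>
      intro hi
      -- The majorant satisfies the summed inequality with equality, so strong induction closes.
      have hsum : ∀ l, 2 * B + 2 * S * c * ∑ a ∈ range l, 2 * B * (1 + 2 * S * c) ^ a =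
          2 * B * (1 + 2 * S * c) ^ l := by
        intro l
        induction l with
        | zero => simp
        | succ l hl => rw [sum_range_succ, mul_add, ← add_assoc, hl, pow_succ]; ring
      rw [← hsum i]
      refine (hstep i hi).trans ?_
      gcongr with a ha
      have := mem_range.1 ha
      exact ih a this (by omega)
  intro m hm
  have hexp : 2 * B * (1 + 2 * S * c) ^ n ≤ 2 * B * Real.exp (2 * S * (n * c)) := by
    refine mul_le_mul_of_nonneg_left ?_ (by positivity)
    calc (1 + 2 * S * c) ^ n ≤ Real.exp (2 * S * c) ^ n := by
          gcongr
          linarith [Real.add_one_le_exp (2 * S * c)]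
      _ = _ := by rw [← Real.exp_nat_mul]; ring_nf
  have hgoal : ‖w m‖ ≤ 2 * B * (1 + 2 * S * c) ^ n := by
    have hone : (1 : ℝ) ≤ 1 + 2 * S * c := by nlinarith
    by_cases hmk : m < k
    · have h0 := hS w ε 0 0 hε (by simp) m (by omega)
      have h1 : S * (ε + 0) ≤ B := by
        rw [hB]; gcongr; positivity
      nlinarith [one_le_pow₀ hone (n := n)]
    · obtain ⟨i, rfl⟩ : ∃ i, m = i + k := ⟨m - k, by omega⟩
      refine (hpow i (by omega)).trans ?_
      exact mul_le_mul_of_nonneg_left (pow_le_pow_right₀ hone (by omega)) (by positivity)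
  rw [hB] at hexp hgoal
  linarith

end ZeroStability

/-! ### Zero-stability and order conditions of the BDF methods. -/

section ZeroStability

variable {E : Type*} [NormedAddCommGroup E] [NormedSpace ℝ E]

/-- The BDF methods with at most six steps are zero-stable. -/
theorem BDF_exists_zeroStableWith {k : ℕ} (hk : 1 ≤ k) (hk6 : k ≤ 6) :
    ∃ S : ℝ, 0 ≤ S ∧ ZeroStableWith E k (BDF k).α S := by
  have hα : (BDF k).α k ≠ 0 := (BDF_leading_pos k hk).ne'
  -- The lists are the coefficients of `q` and `r` in `z^J = q σ + r`, constant term first. Since `∑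
  -- |r_j| < 1`, such an identity excludes zeros of `σ` with `|z| ≥ 1`.
  have cert : ∀ {k J : ℕ}, 1 ≤ k → k ≤ J + 1 → (BDF k).α k ≠ 0 → ∀ q r : List ℝ,
      ∑ j ∈ range J, |r.getD j 0| < 1 →
      (∀ (w : ℕ → E) (n : ℕ), w (n + J + 1) - w (n + J) =
        ∑ i ∈ range (J + 2 - k), q.getD i 0 • ∑ j ∈ range (k + 1), (BDF k).α j • w (n + i + j) +
        ∑ j ∈ range J, r.getD j 0 • (w (n + j + 1) - w (n + j))) →
      ∃ S : ℝ, 0 ≤ S ∧ ZeroStableWith E k (BDF k).α S :=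
    fun hk hJ hα q r hr hqr => exists_zeroStableWith hk hJ hα hr hqr
  interval_cases k
  · refine cert (J := 0) le_rfl (by norm_num) hα [1] [] (by simp) fun w n => ?_
    simp [BDF, sum_range_succ, add_assoc]
    module
  · refine cert (J := 1) (by norm_num) (by norm_num) hα [2 / 3] [1 / 3]
      (by norm_num [sum_range_succ, abs_of_pos]) fun w n => ?_
    simp [BDF, sum_range_succ, sum_Icc_succ_top, add_assoc]
    module
  · refine cert (J := 2) (by norm_num) (by norm_num) hα [6 / 11] [-2 / 11, 7 / 11]
      (by norm_num [sum_range_succ, abs_of_pos, abs_of_neg]) fun w n => ?_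
    simp [BDF, sum_range_succ, sum_Icc_succ_top, Nat.choose, add_assoc]
    module
  · refine cert (J := 4) (by norm_num) (by norm_num) hα [48 / 125, 60 / 125]
      [12 / 125, -37 / 125, 27 / 125, 15 / 125]
      (by norm_num [sum_range_succ, abs_of_pos, abs_of_neg]) fun w n => ?_
    simp [BDF, sum_range_succ, sum_Icc_succ_top, Nat.choose, add_assoc]
    module
  · refine cert (J := 6) (by norm_num) (by norm_num) hα [60 / 274, 120 / 274, 120 / 274]
      [-12 / 274, 39 / 274, -35 / 274, 15 / 274, -85 / 274, 52 / 274]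
      (by norm_num [sum_range_succ, abs_of_pos, abs_of_neg]) fun w n => ?_
    simp [BDF, sum_range_succ, sum_Icc_succ_top, Nat.choose, add_assoc]
    module
  · refine cert (J := 9) (by norm_num) (by norm_num) hα
      [-120 / 735, -180 / 735, 120 / 735, 420 / 735, 300 / 735]
      [-20 / 735, 94 / 735, -120 / 735, -69 / 735, 227 / 735, 12 / 735, 23 / 735, 12 / 735,
        36 / 735]
      (by norm_num [sum_range_succ, abs_of_pos, abs_of_neg]) fun w n => ?_
    simp [BDF, sum_range_succ, sum_Icc_succ_top, Nat.choose, add_assoc]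
    module

set_option maxHeartbeats 1000000 in
/-- The order conditions of the `k`-step BDF method for `k ≤ 6`. -/
theorem BDF_order_conditions {k : ℕ} (hk : 1 ≤ k) (hk6 : k ≤ 6) {i : ℕ} (hi : i ≤ k) :
    ∑ j ∈ range (k + 1), (BDF k).α j * ((j : ℝ) - k) ^ i = if i = 1 then 1 else 0 := by
  -- Conceptually, the method differentiates the interpolation polynomial at the newest node, which
  -- is exact up to degree `k`. For `i = 0` the node `j = k` enters through `0 ^ 0 = 1`.
  interval_cases k <;> interval_cases i <;>
    norm_num [BDF, sum_range_succ, sum_Icc_succ_top, Nat.choose]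

end ZeroStability

/-! ### Taylor expansion of multistep combinations. -/

section Taylor

variable {E : Type*} [NormedAddCommGroup E] [NormedSpace ℝ E]

/-- Taylor's formula for a function with a chain of derivatives on an interval. -/
theorem taylor_norm_sub_le {a b C : ℝ} {m : ℕ} {Y : ℕ → ℝ → E}
    (hY : ∀ i < m, ∀ t ∈ Set.Icc a b, HasDerivWithinAt (Y i) (Y (i + 1) t) (Set.Icc a b) t)
    (hC : ∀ t ∈ Set.Icc a b, ‖Y m t‖ ≤ C) {c s : ℝ} (hc : c ∈ Set.Icc a b)
    (hs : s ∈ Set.Icc a b) :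
    ‖Y 0 s - ∑ i ∈ range m, ((s - c) ^ i / (i.factorial : ℝ)) • Y i c‖ ≤ C * |s - c| ^ m := by
  -- The derivative of the remainder is the remainder, one order lower, of the shifted chain `Y (i +
  -- 1)`. The mean value inequality on the segment from `c` to `s` supplies the missing factor `|s -
  -- c|`.
  induction m generalizing Y s with
  | zero => simpa using hC s hs
  | succ m ih =>
    have C0 : 0 ≤ C := (norm_nonneg _).trans (hC s hs)
    have hsub : Set.uIcc c s ⊆ Set.Icc a b := Set.uIcc_subset_Icc hc hs
    set u : ℝ → E := fun x =>
      Y 0 x - ∑ i ∈ range (m + 1), ((x - c) ^ i / (i.factorial : ℝ)) • Y i c with hu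
    have hder : ∀ x ∈ Set.uIcc c s, HasDerivWithinAt u
        (Y 1 x - ∑ i ∈ range m, ((x - c) ^ i / (i.factorial : ℝ)) • Y (i + 1) c)
        (Set.uIcc c s) x := by
      intro x hx
      refine ((hY 0 (by omega) x (hsub hx)).mono hsub).sub ?_
      have h1 : ∀ i ∈ range (m + 1), HasDerivWithinAt
          (fun x : ℝ => ((x - c) ^ i / (i.factorial : ℝ)) • Y i c)
          ((i * (x - c) ^ (i - 1) / (i.factorial : ℝ)) • Y i c) (Set.uIcc c s) x := by
        intro i _
        have : HasDerivAt (fun x : ℝ => (x - c) ^ i / (i.factorial : ℝ))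
            (i * (x - c) ^ (i - 1) / (i.factorial : ℝ)) x := by
          simpa using (((hasDerivAt_id x).sub_const c).pow i).div_const (i.factorial : ℝ)
        exact (this.smul_const (Y i c)).hasDerivWithinAt
      have h2 := HasDerivWithinAt.fun_sum h1
      rw [sum_range_succ'] at h2
      convert h2 using 1
      simp only [Nat.cast_zero, zero_mul, zero_div, zero_smul, add_zero]
      refine sum_congr rfl fun i _ => ?_
      congr 1
      rw [Nat.factorial_succ, Nat.add_sub_cancel]
      push_cast
      have : (i.factorial : ℝ) ≠ 0 := by positivity
      have : ((i : ℝ) + 1) ≠ 0 := by positivity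
      field_simp
    have hbound : ∀ x ∈ Set.uIcc c s,
        ‖Y 1 x - ∑ i ∈ range m, ((x - c) ^ i / (i.factorial : ℝ)) • Y (i + 1) c‖ ≤
          C * |s - c| ^ m := by
      intro x hx
      refine (ih (Y := fun i => Y (i + 1)) (fun i hi => hY (i + 1) (by omega)) hC (hsub hx)).trans ?_
      have := Set.abs_sub_left_of_mem_uIcc hx
      gcongr
    have h0 : u c = 0 := by
      rw [hu]
      simp only [sum_range_succ', sub_self]
      simp
    have := (convex_uIcc c s).norm_image_sub_le_of_norm_hasDerivWithin_le hder hbound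
      Set.left_mem_uIcc Set.right_mem_uIcc
    rw [h0, sub_zero, Real.norm_eq_abs, mul_assoc, ← pow_succ] at this
    exact this

/-- Taylor expansion of a linear multistep combination of values of a function. -/
theorem multistep_taylor_norm_sub_le {a b C : ℝ} {m k : ℕ} {Y : ℕ → ℝ → E} (α : ℕ → ℝ)
    (hY : ∀ i < m, ∀ t ∈ Set.Icc a b, HasDerivWithinAt (Y i) (Y (i + 1) t) (Set.Icc a b) t)
    (hC : ∀ t ∈ Set.Icc a b, ‖Y m t‖ ≤ C) {h : ℝ} (h0 : 0 < h) {n : ℕ}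
    (hn : a + ((n + k : ℕ) : ℝ) * h ≤ b) :
    ‖∑ j ∈ range (k + 1), α j • Y 0 (a + ((n + j : ℕ) : ℝ) * h) -
      ∑ i ∈ range m, (h ^ i / (i.factorial : ℝ) *
        ∑ j ∈ range (k + 1), α j * ((j : ℝ) - k) ^ i) • Y i (a + ((n + k : ℕ) : ℝ) * h)‖ ≤
      ((∑ j ∈ range (k + 1), |α j|) * k ^ m * C) * h ^ m := by
  -- All nodes are expanded about the newest one, where BDF evaluates `f`.
  set c := a + ((n + k : ℕ) : ℝ) * h with hcdef
  have hc : c ∈ Set.Icc a b :=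
    ⟨by rw [hcdef]; linarith [show 0 ≤ ((n + k : ℕ) : ℝ) * h by positivity], hn⟩
  have C0 : 0 ≤ C := (norm_nonneg _).trans (hC c hc)
  have hswap : ∑ i ∈ range m, (h ^ i / (i.factorial : ℝ) *
        ∑ j ∈ range (k + 1), α j * ((j : ℝ) - k) ^ i) • Y i c =
      ∑ j ∈ range (k + 1), α j •
        ∑ i ∈ range m, ((a + ((n + j : ℕ) : ℝ) * h - c) ^ i / (i.factorial : ℝ)) • Y i c := by
    simp only [smul_sum, mul_sum, sum_smul]
    rw [sum_comm]
    refine sum_congr rfl fun j _ => sum_congr rfl fun i _ => ?_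
    rw [smul_smul, hcdef]
    congr 1
    have : a + ((n + j : ℕ) : ℝ) * h - (a + ((n + k : ℕ) : ℝ) * h) = ((j : ℝ) - k) * h := by
      push_cast; ring
    rw [this, mul_pow]
    ring
  rw [hswap, ← sum_sub_distrib]
  refine (norm_sum_le _ _).trans ?_
  rw [sum_mul, sum_mul, sum_mul]
  refine sum_le_sum fun j hj => ?_
  have hj : j ≤ k := Nat.lt_succ_iff.1 (mem_range.1 hj)
  have hjk : (j : ℝ) ≤ k := by exact_mod_cast hj
  have hj0 : (0 : ℝ) ≤ j := by positivity
  have hs : a + ((n + j : ℕ) : ℝ) * h ∈ Set.Icc a b := by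
    refine ⟨by linarith [show 0 ≤ ((n + j : ℕ) : ℝ) * h by positivity], le_trans ?_ hn⟩
    rw [hcdef]; push_cast; gcongr
  rw [← smul_sub, norm_smul, Real.norm_eq_abs]
  have hdist : |a + ((n + j : ℕ) : ℝ) * h - c| ≤ k * h := by
    rw [hcdef, abs_le]; push_cast
    constructor <;> nlinarith
  calc |α j| * _ ≤ |α j| * (C * (k * h) ^ m) := by
        refine mul_le_mul_of_nonneg_left ((taylor_norm_sub_le hY hC hc hs).trans ?_) (abs_nonneg _)
        gcongr
    _ = _ := by rw [mul_pow]; ring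

/-- The iterated derivatives of a `C^m` function on an interval form a chain of derivatives. -/
theorem ContDiffOn.hasDerivWithinAt_iteratedDerivWithin {a b : ℝ} (hab : a < b) {m : ℕ}
    {y : ℝ → E} (hy : ContDiffOn ℝ m y (Set.Icc a b)) :
    ∀ i < m, ∀ t ∈ Set.Icc a b, HasDerivWithinAt (iteratedDerivWithin i y (Set.Icc a b))
      (iteratedDerivWithin (i + 1) y (Set.Icc a b) t) (Set.Icc a b) t := by
  intro i hi t ht
  rw [iteratedDerivWithin_succ]
  exact (hy.differentiableOn_iteratedDerivWithin (by exact_mod_cast hi) (uniqueDiffOn_Icc hab)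
    t ht).hasDerivWithinAt

theorem ContDiffOn.exists_norm_iteratedDerivWithin_le {a b : ℝ} (hab : a < b) {m : ℕ}
    {y : ℝ → E} (hy : ContDiffOn ℝ m y (Set.Icc a b)) :
    ∃ C : ℝ, ∀ t ∈ Set.Icc a b, ‖iteratedDerivWithin m y (Set.Icc a b) t‖ ≤ C :=
  isCompact_Icc.exists_bound_of_continuousOn
    (hy.continuousOn_iteratedDerivWithin le_rfl (uniqueDiffOn_Icc hab))

end Taylor

/-! ### Global solvability of linear differential equations. -/

section LinearODE

variable {E : Type*} [NormedAddCommGroup E] [NormedSpace ℝ E] [FiniteDimensional ℝ E]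

/-- A linear differential equation has a solution on the whole interval. -/
theorem exists_linear_ode_solution {a b : ℝ} (hab : a < b) {A : ℝ → E →L[ℝ] E} {g : ℝ → E}
    (hA : ContinuousOn A (Set.Icc a b)) (hg : ContinuousOn g (Set.Icc a b)) :
    ∃ e : ℝ → E, e a = 0 ∧
      ∀ t ∈ Set.Icc a b, HasDerivWithinAt e (A t (e t) + g t) (Set.Icc a b) t := by
  obtain ⟨MA, hMA⟩ := isCompact_Icc.exists_bound_of_continuousOn hA
  obtain ⟨Mg, hMg⟩ := isCompact_Icc.exists_bound_of_continuousOn hg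
  have ha : a ∈ Set.Icc a b := Set.left_mem_Icc.2 hab.le
  have MA0 : 0 ≤ MA := (norm_nonneg _).trans (hMA a ha)
  have Mg0 : 0 ≤ Mg := (norm_nonneg _).trans (hMg a ha)
  set B := gronwallBound 0 MA Mg (b - a) with hB
  have B0 : 0 ≤ B := by
    have := gronwallBound_mono (δ := 0) le_rfl Mg0 MA0 (sub_nonneg.2 hab.le)
    rwa [gronwallBound_x0] at this
  -- Cutting off outside a ball makes the field bounded and globally Lipschitz, so a single
  -- application of Picard–Lindelöf covers `[a, b]`. As `‖R x‖ ≤ ‖x‖`, Gronwall bounds the solution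
  -- of the truncated equation by `B` too, and there `R` is the identity.
  let χ : ContDiffBump (0 : E) := ⟨B + 1, B + 2, by linarith, by linarith⟩
  set R : E → E := fun x => χ x • x with hR
  have hRsmooth : ContDiff ℝ 1 R := χ.contDiff.smul contDiff_id
  have hRsupp : HasCompactSupport R := χ.hasCompactSupport.smul_right
  obtain ⟨KR, hKR⟩ := hRsmooth.lipschitzWith_of_hasCompactSupport hRsupp one_ne_zero
  obtain ⟨MR, hMR⟩ := hRsmooth.continuous.bounded_above_of_compact_support hRsupp
  have MR0 : 0 ≤ MR := (norm_nonneg _).trans (hMR 0)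
  have hRle : ∀ x, ‖R x‖ ≤ ‖x‖ := fun x => by
    rw [hR, norm_smul, Real.norm_eq_abs, abs_of_nonneg χ.nonneg]
    exact mul_le_of_le_one_left (norm_nonneg _) χ.le_one
  have hPL : IsPicardLindelof (fun t x => A t (R x) + g t) ⟨a, ha⟩ (0 : E)
      ((MA * MR + Mg) * (b - a)).toNNReal 0 (MA * MR + Mg).toNNReal (MA.toNNReal * KR) := by
    refine ⟨fun t ht => ?_, fun x _ => ?_, fun t ht x _ => ?_, ?_⟩
    · have h1 : LipschitzWith MA.toNNReal (A t) :=
        (A t).lipschitz.weaken (by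
          rw [← NNReal.coe_le_coe, Real.coe_toNNReal _ MA0]; exact hMA t ht)
      have := (h1.comp hKR).add (LipschitzWith.const (g t))
      rw [add_zero] at this
      exact this.lipschitzOnWith
    · exact (hA.clm_apply continuousOn_const).add hg
    · rw [Real.coe_toNNReal _ (by positivity)]
      refine (norm_add_le _ _).trans (add_le_add (((A t).le_opNorm _).trans ?_) (hMg t ht))
      exact mul_le_mul (hMA t ht) (hMR x) (norm_nonneg _) MA0
    · have : 0 ≤ b - a := by linarith
      rw [Real.coe_toNNReal _ (by positivity), Real.coe_toNNReal _ (by positivity)]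
      simp [this]
  obtain ⟨e, he0, he⟩ := hPL.exists_eq_forall_mem_Icc_hasDerivWithinAt₀
  refine ⟨e, he0, fun t ht => ?_⟩
  have hbound : ‖e t‖ ≤ B := by
    have h1 := norm_le_gronwallBound_of_norm_deriv_right_le (δ := 0) (K := MA) (ε := Mg)
      (fun t ht => (he t ht).continuousWithinAt)
      (fun t ht => (he t (Set.Ico_subset_Icc_self ht)).mono_of_mem_nhdsWithin
        (Icc_mem_nhdsGE_of_mem ht)) (by simpa using he0)
      (fun t ht => (norm_add_le _ _).trans (add_le_add (((A t).le_opNorm _).trans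
        (mul_le_mul (hMA t (Set.Ico_subset_Icc_self ht)) (hRle _) (norm_nonneg _) MA0))
        (hMg t (Set.Ico_subset_Icc_self ht)))) t ht
    exact h1.trans (gronwallBound_mono le_rfl Mg0 MA0 (by linarith [ht.2]))
  have hRe : R (e t) = e t := by
    rw [hR]
    simp only
    rw [χ.one_of_mem_closedBall, one_smul]
    rw [mem_closedBall_zero_iff]
    show ‖e t‖ ≤ B + 1
    linarith
  have := he t ht
  rwa [hRe] at this

end LinearODE

/-! ### Regularity of the solution and estimates on tubes around it. -/

section ODESolution

variable {E : Type*} [NormedAddCommGroup E] {f : ℝ → E → E} {D : Set (ℝ × E)} {t₀ T : ℝ}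
  {y : ℝ → E}

/-- The graph is compact, so some closed thickening of it fits into `D`; in the maximum metric a
tube point has distance at most `ρ` from the graph point at the same time. -/
theorem exists_tube_subset (hy : ContinuousOn y (Set.Icc t₀ T)) (hDo : IsOpen D)
    (hD : ∀ t ∈ Set.Icc t₀ T, (t, y t) ∈ D) : ∃ ρ > (0 : ℝ), tube y t₀ T ρ ⊆ D := by
  have hc : IsCompact ((fun t => (t, y t)) '' Set.Icc t₀ T) :=
    isCompact_Icc.image_of_continuousOn (continuousOn_id.prodMk hy)
  obtain ⟨ρ, hρ, h⟩ := hc.exists_cthickening_subset_open hDo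
    (by rintro _ ⟨t, ht, rfl⟩; exact hD t ht)
  refine ⟨ρ, hρ, fun x hx => h ?_⟩
  refine Metric.mem_cthickening_of_dist_le x (x.1, y x.1) ρ _ ⟨x.1, hx.1, rfl⟩ ?_
  rw [Prod.dist_eq, dist_self, dist_eq_norm]
  exact max_le hρ.le hx.2

variable [NormedSpace ℝ E]

theorem IsODESolution.continuousOn (hy : IsODESolution f t₀ T y) :
    ContinuousOn y (Set.Icc t₀ T) := fun t ht => (hy t ht).continuousWithinAt

theorem IsODESolution.derivWithin (hT : t₀ < T) (hy : IsODESolution f t₀ T y) {t : ℝ}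
    (ht : t ∈ Set.Icc t₀ T) : derivWithin y (Set.Icc t₀ T) t = f t (y t) :=
  (hy t ht).derivWithin ((uniqueDiffOn_Icc hT) t ht)

/-- A solution of a differential equation is smoother than the right-hand side. -/
theorem IsODESolution.contDiffOn (hT : t₀ < T) (hy : IsODESolution f t₀ T y) {q : ℕ}
    (hf : ContDiffOn ℝ q (fun x : ℝ × E => f x.1 x.2) D)
    (hD : ∀ t ∈ Set.Icc t₀ T, (t, y t) ∈ D) :
    ContDiffOn ℝ (q + 1 : ℕ) y (Set.Icc t₀ T) := by
  -- Bootstrapping: if `y` is `C^n` with `n ≤ q`, then so is `y' = f(t, y)`.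
  have key : ∀ n : ℕ, n ≤ q + 1 → ContDiffOn ℝ n y (Set.Icc t₀ T) := by
    intro n
    induction n with
    | zero => exact fun _ => contDiffOn_zero.2 hy.continuousOn
    | succ n ih =>
      intro hn
      rw [Nat.cast_add, Nat.cast_one, contDiffOn_succ_iff_derivWithin (uniqueDiffOn_Icc hT)]
      refine ⟨fun t ht => (hy t ht).differentiableWithinAt, by simp, ?_⟩
      have h1 : ContDiffOn ℝ n (fun t => (t, y t)) (Set.Icc t₀ T) :=
        contDiffOn_id.prodMk (ih (by omega))
      have h2 : ContDiffOn ℝ n (fun x : ℝ × E => f x.1 x.2) D :=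
        hf.of_le (by exact_mod_cast (by omega : n ≤ q))
      exact (h2.comp h1 hD).congr fun t ht => hy.derivWithin hT ht
  exact key _ le_rfl

/-- The derivative of `f` in the state along the solution. -/
noncomputable def stateDeriv (f : ℝ → E → E) (y : ℝ → E) (t : ℝ) : E →L[ℝ] E :=
  (fderiv ℝ (fun x : ℝ × E => f x.1 x.2) (t, y t)).comp (ContinuousLinearMap.inr ℝ ℝ E)

theorem IsODESolution.contDiffOn_stateDeriv (hT : t₀ < T) (hy : IsODESolution f t₀ T y)
    (hDo : IsOpen D) (hf : ContDiffOn ℝ 2 (fun x : ℝ × E => f x.1 x.2) D)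
    (hD : ∀ t ∈ Set.Icc t₀ T, (t, y t) ∈ D) :
    ContDiffOn ℝ 1 (stateDeriv f y) (Set.Icc t₀ T) := by
  have h1 : ContDiffOn ℝ 1 (fderiv ℝ (fun x : ℝ × E => f x.1 x.2)) D :=
    hf.fderiv_of_isOpen hDo (by norm_num)
  have h2 : ContDiffOn ℝ 1 (fun t => (t, y t)) (Set.Icc t₀ T) :=
    contDiffOn_id.prodMk ((hy.contDiffOn hT (q := 2) hf hD).of_le (by norm_num))
  exact (h1.comp h2 hD).clm_comp contDiffOn_const

theorem hasFDerivAt_state (hDo : IsOpen D)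
    (hf : ContDiffOn ℝ 2 (fun x : ℝ × E => f x.1 x.2) D) {t : ℝ} {u : E} (hu : (t, u) ∈ D) :
    HasFDerivAt (f t) ((fderiv ℝ (fun x : ℝ × E => f x.1 x.2) (t, u)).comp
      (ContinuousLinearMap.inr ℝ ℝ E)) u := by
  have h1 : HasFDerivAt (fun x : ℝ × E => f x.1 x.2) _ (t, u) :=
    ((hf.differentiableOn (by norm_num)).differentiableAt (hDo.mem_nhds hu)).hasFDerivAt
  exact h1.comp (f := fun u : E => (t, u)) u (hasFDerivAt_prodMk_right t u)

theorem isCompact_tube [FiniteDimensional ℝ E] (hy : ContinuousOn y (Set.Icc t₀ T)) (ρ : ℝ) :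
    IsCompact (tube y t₀ T ρ) := by
  have : tube y t₀ T ρ =
      (fun x : ℝ × E => (x.1, y x.1 + x.2)) '' (Set.Icc t₀ T ×ˢ Metric.closedBall 0 ρ) := by
    ext ⟨t, u⟩
    simp only [tube, Set.mem_ofPred_eq, Set.mem_image, Set.mem_prod, mem_closedBall_zero_iff,
      Prod.mk.injEq, Prod.exists]
    constructor
    · exact fun h => ⟨t, u - y t, ⟨h.1, h.2⟩, rfl, by abel⟩
    · rintro ⟨t', v, ⟨h1, h2⟩, rfl, rfl⟩
      exact ⟨h1, by simpa using h2⟩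
  rw [this]
  have : ProperSpace E := FiniteDimensional.proper ℝ E
  refine (isCompact_Icc.prod (isCompact_closedBall _ _)).image_of_continuousOn ?_
  exact continuousOn_fst.prodMk
    ((hy.comp continuousOn_fst fun x hx => hx.1).add continuousOn_snd)

/-- On a tube around the solution the right-hand side is Lipschitz in the state, and it is
approximated by its linearization with a quadratic error. -/
theorem exists_tube_estimates [FiniteDimensional ℝ E] (hT : t₀ < T) (hy : IsODESolution f t₀ T y)
    (hDo : IsOpen D) (hf : ContDiffOn ℝ 2 (fun x : ℝ × E => f x.1 x.2) D)
    (hD : ∀ t ∈ Set.Icc t₀ T, (t, y t) ∈ D) :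
    ∃ ρ > (0 : ℝ), tube y t₀ T ρ ⊆ D ∧
      (∃ L : ℝ, 0 ≤ L ∧ ∀ (t : ℝ) (u v : E), (t, u) ∈ tube y t₀ T ρ → (t, v) ∈ tube y t₀ T ρ →
        ‖f t u - f t v‖ ≤ L * ‖u - v‖) ∧
      ∃ C : ℝ, 0 ≤ C ∧ ∀ (t : ℝ) (u : E), (t, u) ∈ tube y t₀ T ρ →
        ‖f t u - f t (y t) - stateDeriv f y t (u - y t)‖ ≤ C * ‖u - y t‖ ^ 2 := by
  obtain ⟨ρ, hρ, hsub⟩ := exists_tube_subset hy.continuousOn hDo hD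
  have hcomp := isCompact_tube (ρ := ρ) hy.continuousOn
  set F : ℝ × E → E := fun x => f x.1 x.2 with hF
  have hF' : ContDiffOn ℝ 1 (fderiv ℝ F) D := hf.fderiv_of_isOpen hDo (by norm_num)
  have hF'' : ContinuousOn (fderiv ℝ (fderiv ℝ F)) D := hF'.continuousOn_fderiv_of_isOpen hDo le_rfl
  obtain ⟨L, hL⟩ := hcomp.exists_bound_of_continuousOn (hF'.continuousOn.mono hsub)
  obtain ⟨C, hC⟩ : ∃ C, ∀ x ∈ tube y t₀ T ρ, ‖fderiv ℝ (fderiv ℝ F) x‖ ≤ C :=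
    IsCompact.exists_bound_of_continuousOn (E := ℝ × E →L[ℝ] ℝ × E →L[ℝ] E) hcomp
      (hF''.mono hsub)
  have hmem : (t₀, y t₀) ∈ tube y t₀ T ρ := ⟨Set.left_mem_Icc.2 hT.le, by simpa using hρ.le⟩
  have L0 : 0 ≤ L := (norm_nonneg _).trans (hL _ hmem)
  have C0 : 0 ≤ C := (ContinuousLinearMap.opNorm_nonneg _).trans (hC _ hmem)
  have hcomp_le : ∀ B : ℝ × E →L[ℝ] E, ‖B.comp (ContinuousLinearMap.inr ℝ ℝ E)‖ ≤ ‖B‖ := fun B =>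
    (B.opNorm_comp_le _).trans (mul_le_of_le_one_right (norm_nonneg _)
      (ContinuousLinearMap.norm_inr_le_one ℝ ℝ E))
  -- The tube need not be convex, but its time slices are balls, so the mean value inequality is
  -- applied in the state at fixed `t`.
  have hslice : ∀ t ∈ Set.Icc t₀ T, ∀ u ∈ Metric.closedBall (y t) ρ, (t, u) ∈ tube y t₀ T ρ :=
    fun t ht u hu => ⟨ht, by rwa [mem_closedBall_iff_norm] at hu⟩
  refine ⟨ρ, hρ, hsub, ⟨L, L0, fun t u v hu hv => ?_⟩, C, C0, fun t u hu => ?_⟩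
  · refine (convex_closedBall (y t) ρ).norm_image_sub_le_of_norm_hasFDerivWithin_le
      (fun w hw => (hasFDerivAt_state hDo hf (hsub (hslice t hu.1 w hw))).hasFDerivWithinAt)
      (fun w hw => (hcomp_le _).trans (hL _ (hslice t hu.1 w hw)))
      (mem_closedBall_iff_norm.2 hv.2) (mem_closedBall_iff_norm.2 hu.2)
  · have hd : ∀ w ∈ Metric.closedBall (y t) ρ,
        ‖fderiv ℝ F (t, w) - fderiv ℝ F (t, y t)‖ ≤ C * ‖w - y t‖ := by
      intro w hw
      have h1 : ∀ x ∈ Metric.closedBall (y t) ρ,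
          HasFDerivWithinAt (fun v : E => fderiv ℝ F (t, v))
            ((fderiv ℝ (fderiv ℝ F) (t, x)).comp (ContinuousLinearMap.inr ℝ ℝ E))
            (Metric.closedBall (y t) ρ) x := by
        intro x hx
        have := ((hF'.differentiableOn (by norm_num)).differentiableAt
          (hDo.mem_nhds (hsub (hslice t hu.1 x hx)))).hasFDerivAt
        exact (this.comp (f := fun u : E => (t, u)) x
          (hasFDerivAt_prodMk_right t x)).hasFDerivWithinAt
      refine (convex_closedBall (y t) ρ).norm_image_sub_le_of_norm_hasFDerivWithin_le h1
        (fun x hx => ((ContinuousLinearMap.opNorm_comp_le _ _).trans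
          (mul_le_of_le_one_right (norm_nonneg _) (ContinuousLinearMap.norm_inr_le_one ℝ ℝ E))).trans
          (hC _ (hslice t hu.1 x hx)))
        (Metric.mem_closedBall_self hρ.le) hw
    have hsubball : Metric.closedBall (y t) ‖u - y t‖ ⊆ Metric.closedBall (y t) ρ :=
      Metric.closedBall_subset_closedBall hu.2
    -- On the ball of radius `‖u - y t‖` the derivative of `f t` minus its linearization is at most
    -- `C * ‖u - y t‖`; the mean value inequality contributes the second such factor.
    have h2 := (convex_closedBall (y t) ‖u - y t‖).norm_image_sub_le_of_norm_hasFDerivWithin_le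
      (f := fun w => f t w - stateDeriv f y t w) (C := C * ‖u - y t‖)
      (fun w hw => ((hasFDerivAt_state hDo hf
        (hsub (hslice t hu.1 w (hsubball hw)))).hasFDerivWithinAt.sub
        (stateDeriv f y t).hasFDerivWithinAt))
      (fun w hw => by
        rw [stateDeriv, ← ContinuousLinearMap.sub_comp]
        refine (hcomp_le _).trans ((hd w (hsubball hw)).trans ?_)
        exact mul_le_mul_of_nonneg_left (mem_closedBall_iff_norm.1 hw) C0)
      (Metric.mem_closedBall_self (norm_nonneg _)) (mem_closedBall_iff_norm.2 le_rfl)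
    have h3 : f t u - f t (y t) - stateDeriv f y t (u - y t) =
        f t u - stateDeriv f y t u - (f t (y t) - stateDeriv f y t (y t)) := by
      rw [map_sub]; abel
    rw [h3, pow_two, ← mul_assoc]
    exact h2

end ODESolution

/-! ### Convergence of BDF, the error expansion and its extrapolation. -/

section Convergence

variable {E : Type*} [NormedAddCommGroup E] [NormedSpace ℝ E]

theorem BDF_step_iff {k : ℕ} {f : ℝ → E → E} {t₀ h : ℝ} {Y : ℕ → E} {n : ℕ} :
    (BDF k).Step f t₀ h Y n ↔ ∑ j ∈ range (k + 1), (BDF k).α j • Y (n + j) =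
      h • f (t₀ + ((n + k : ℕ) : ℝ) * h) (Y (n + k)) := by
  have : ∑ j ∈ range (k + 1), (h * (BDF k).β j) • f (t₀ + ((n + j : ℕ) : ℝ) * h) (Y (n + j)) =
      h • f (t₀ + ((n + k : ℕ) : ℝ) * h) (Y (n + k)) := by
    rw [sum_eq_single_of_mem k (self_mem_range_succ k)]
    · simp [BDF]
    · intro j _ hj
      simp [BDF, hj]
  rw [← this]
  rfl

/-- The discrete Gronwall inequality on the grid points of an interval. -/
theorem ZeroStableWith.norm_le_of_grid {k q : ℕ} {α : ℕ → ℝ} {S : ℝ}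
    (hS : ZeroStableWith E k α S) (hk : 1 ≤ k) (S0 : 0 ≤ S) {w : ℕ → E} {t₀ T h L B M : ℝ}
    (h0 : 0 < h) (L0 : 0 ≤ L) (B0 : 0 ≤ B) (hSh : S * (h * L) ≤ 1 / 2)
    (hM : ∀ j < k, ‖w j‖ ≤ M * h ^ q)
    (hw : ∀ i : ℕ, t₀ + ((i + k : ℕ) : ℝ) * h ≤ T →
      ‖∑ j ∈ range (k + 1), α j • w (i + j)‖ ≤ h * L * ‖w (i + k)‖ + B * h ^ (q + 1))
    {n : ℕ} (hn : t₀ + (n : ℝ) * h ≤ T) :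
    ‖w n‖ ≤ 2 * S * (M + (T - t₀) * B) * Real.exp (2 * S * ((T - t₀) * L)) * h ^ q := by
  have hNn : n + 1 - k ≤ n := by omega
  have hN : ((n + 1 - k : ℕ) : ℝ) * h ≤ T - t₀ := by
    have : ((n + 1 - k : ℕ) : ℝ) ≤ n := by exact_mod_cast hNn
    nlinarith
  have h1 := hS.norm_le hk S0 (n := n + 1 - k) (c := h * L) (η := B * h ^ (q + 1)) (by positivity)
    (by positivity) hSh hM (fun i hi => hw i (by
      have : ((i + k : ℕ) : ℝ) ≤ n := by exact_mod_cast (by omega : i + k ≤ n)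
      nlinarith)) n (by omega)
  have M0 : 0 ≤ M * h ^ q := (norm_nonneg _).trans (hM 0 hk)
  have hT0 : 0 ≤ T - t₀ := le_trans (by positivity) hN
  have hpos : 0 ≤ 2 * S * (M * h ^ q + (T - t₀) * (B * h ^ q)) :=
    mul_nonneg (by positivity) (add_nonneg M0 (by positivity))
  refine h1.trans ?_
  calc 2 * S * (M * h ^ q + ((n + 1 - k : ℕ) : ℝ) * (B * h ^ (q + 1))) *
        Real.exp (2 * S * (((n + 1 - k : ℕ) : ℝ) * (h * L)))
      = 2 * S * (M * h ^ q + ((n + 1 - k : ℕ) : ℝ) * h * (B * h ^ q)) *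
        Real.exp (2 * S * (((n + 1 - k : ℕ) : ℝ) * h * L)) := by
        congr 2
        · ring
        · ring
    _ ≤ 2 * S * (M * h ^ q + (T - t₀) * (B * h ^ q)) *
        Real.exp (2 * S * ((T - t₀) * L)) := by gcongr
    _ = _ := by ring

/-- The Taylor polynomial of a BDF combination of at least first and at most full order. -/
theorem BDF_taylor_sum {k m : ℕ} (hk : 1 ≤ k) (hk6 : k ≤ 6) (hm : 2 ≤ m) (hmk : m ≤ k + 1)
    (h : ℝ) (v : ℕ → E) :
    ∑ i ∈ range m, (h ^ i / (i.factorial : ℝ) *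
      ∑ j ∈ range (k + 1), (BDF k).α j * ((j : ℝ) - k) ^ i) • v i = h • v 1 := by
  rw [sum_eq_single_of_mem 1 (mem_range.2 (by omega)), BDF_order_conditions hk hk6 hk]
  · simp
  · intro i hi hi1
    rw [BDF_order_conditions hk hk6 (by have := mem_range.1 hi; omega), if_neg hi1, mul_zero,
      zero_smul]

/-- The defect of a BDF method for a function of class `C^m`, with `m` at most the order of the
method plus one. -/
theorem BDF_defect_le {k m : ℕ} (hk : 1 ≤ k) (hk6 : k ≤ 6) (hm : 2 ≤ m) (hmk : m ≤ k + 1)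
    {t₀ T : ℝ} (hT : t₀ < T) {y : ℝ → E} (hy : ContDiffOn ℝ m y (Set.Icc t₀ T)) :
    ∃ C : ℝ, 0 ≤ C ∧ ∀ h : ℝ, 0 < h → ∀ n : ℕ, t₀ + ((n + k : ℕ) : ℝ) * h ≤ T →
      ‖∑ j ∈ range (k + 1), (BDF k).α j • y (t₀ + ((n + j : ℕ) : ℝ) * h) -
        h • derivWithin y (Set.Icc t₀ T) (t₀ + ((n + k : ℕ) : ℝ) * h)‖ ≤ C * h ^ m := by
  obtain ⟨C, hC⟩ := hy.exists_norm_iteratedDerivWithin_le hT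
  have C0 : 0 ≤ C := (norm_nonneg _).trans (hC t₀ (Set.left_mem_Icc.2 hT.le))
  refine ⟨(∑ j ∈ range (k + 1), |(BDF k).α j|) * k ^ m * C,
    mul_nonneg (mul_nonneg (sum_nonneg fun _ _ => abs_nonneg _) (by positivity)) C0,
    fun h h0 n hn => ?_⟩
  have := multistep_taylor_norm_sub_le (BDF k).α (hy.hasDerivWithinAt_iteratedDerivWithin hT) hC
    h0 hn
  rwa [BDF_taylor_sum hk hk6 hm hmk, iteratedDerivWithin_zero, iteratedDerivWithin_one] at this

/-- The error constant of the BDF method: the leading coefficient of its defect. -/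
noncomputable def BDFErrorConst (k : ℕ) : ℝ :=
  1 / ((k + 1).factorial : ℝ) * ∑ j ∈ range (k + 1), (BDF k).α j * ((j : ℝ) - k) ^ (k + 1)

/-- The leading term of the defect of a BDF method. -/
theorem BDF_defect_expansion {k : ℕ} (hk : 1 ≤ k) (hk6 : k ≤ 6) {t₀ T : ℝ} (hT : t₀ < T)
    {y : ℝ → E} (hy : ContDiffOn ℝ (k + 2 : ℕ) y (Set.Icc t₀ T)) :
    ∃ C : ℝ, 0 ≤ C ∧ ∀ h : ℝ, 0 < h → ∀ n : ℕ, t₀ + ((n + k : ℕ) : ℝ) * h ≤ T →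
      ‖∑ j ∈ range (k + 1), (BDF k).α j • y (t₀ + ((n + j : ℕ) : ℝ) * h) -
        h • derivWithin y (Set.Icc t₀ T) (t₀ + ((n + k : ℕ) : ℝ) * h) -
        (h ^ (k + 1) * BDFErrorConst k) •
          iteratedDerivWithin (k + 1) y (Set.Icc t₀ T) (t₀ + ((n + k : ℕ) : ℝ) * h)‖ ≤
        C * h ^ (k + 2) := by
  obtain ⟨C, hC⟩ := hy.exists_norm_iteratedDerivWithin_le hT
  have C0 : 0 ≤ C := (norm_nonneg _).trans (hC t₀ (Set.left_mem_Icc.2 hT.le))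
  refine ⟨(∑ j ∈ range (k + 1), |(BDF k).α j|) * k ^ (k + 2) * C,
    mul_nonneg (mul_nonneg (sum_nonneg fun _ _ => abs_nonneg _) (by positivity)) C0,
    fun h h0 n hn => ?_⟩
  have := multistep_taylor_norm_sub_le (BDF k).α (hy.hasDerivWithinAt_iteratedDerivWithin hT) hC
    h0 hn
  rw [sum_range_succ _ (k + 1), BDF_taylor_sum hk hk6 (by omega) le_rfl, iteratedDerivWithin_zero,
    iteratedDerivWithin_one, ← sub_sub] at this
  rwa [BDFErrorConst, ← mul_assoc, mul_one_div]

variable {f : ℝ → E → E} {D K : Set (ℝ × E)} {t₀ T : ℝ} {y : ℝ → E}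

theorem sum_smul_error (α : ℕ → ℝ) (k n : ℕ) (h : ℝ) (Y : ℕ → E) :
    ∑ j ∈ range (k + 1), α j • (Y (n + j) - y (t₀ + ((n + j : ℕ) : ℝ) * h)) =
      ∑ j ∈ range (k + 1), α j • Y (n + j) -
        ∑ j ∈ range (k + 1), α j • y (t₀ + ((n + j : ℕ) : ℝ) * h) := by
  simp only [smul_sub, sum_sub_distrib]

/-- Convergence of order `k` of the `k`-step BDF method. -/
theorem BDF_error_le {k : ℕ} (hk : 1 ≤ k) (hk6 : k ≤ 6) (hT : t₀ < T)
    (hy : IsODESolution f t₀ T y) (hyc : ContDiffOn ℝ (k + 1 : ℕ) y (Set.Icc t₀ T))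
    (hyK : ∀ t ∈ Set.Icc t₀ T, (t, y t) ∈ K) (hfK : LipschitzInState f K) (M : ℝ) :
    ∃ h₀ > (0 : ℝ), ∃ C : ℝ, 0 ≤ C ∧ ∀ h : ℝ, 0 < h → h < h₀ → ∀ Y : ℕ → E,
      (BDF k).IsNumericalSolution f t₀ T h K Y → StartWithin k y t₀ h (M * h ^ (k + 1)) Y →
      ∀ n : ℕ, t₀ + (n : ℝ) * h ≤ T → ‖Y n - y (t₀ + (n : ℝ) * h)‖ ≤ C * h ^ k := by
  -- The error satisfies the BDF recursion with residual at most `h L ‖error‖ + C h^(k+1)`.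
  -- Smoothness is required of `y` alone, so the estimate also applies to the merely Lipschitz
  -- extension used in `BDF_wellPosedNear`.
  obtain ⟨S, S0, hS⟩ := BDF_exists_zeroStableWith (E := E) hk hk6
  obtain ⟨C, C0, hC⟩ := BDF_defect_le hk hk6 (m := k + 1) (by omega) le_rfl hT hyc
  obtain ⟨L, hL⟩ := hfK
  set L' := max L 0
  have L0 : 0 ≤ L' := le_max_right _ _
  have hT0 : 0 ≤ T - t₀ := by linarith
  refine ⟨min 1 (1 / (2 * (S * L' + 1))), by positivity,
    2 * S * (|M| + (T - t₀) * C) * Real.exp (2 * S * ((T - t₀) * L')), by positivity, ?_⟩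
  intro h h0 hh Y hY hstart n hn
  have h1 : h ≤ 1 := (hh.trans_le (min_le_left _ _)).le
  have h2 : h * (2 * (S * L' + 1)) ≤ 1 := by
    have := (hh.trans_le (min_le_right _ _)).le
    rwa [le_div_iff₀ (by positivity)] at this
  refine hS.norm_le_of_grid hk S0 (w := fun n => Y n - y (t₀ + (n : ℝ) * h)) h0 L0 C0
    (by linarith) ?_ ?_ hn
  · intro j hj
    refine (hstart j hj).trans ?_
    have hp : h ^ (k + 1) ≤ h ^ k := pow_le_pow_of_le_one h0.le h1 (Nat.le_succ k)
    exact mul_le_mul (le_abs_self M) hp (by positivity) (abs_nonneg M)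
  · intro i hi
    set c := t₀ + ((i + k : ℕ) : ℝ) * h with hc
    have hcI : c ∈ Set.Icc t₀ T :=
      ⟨by rw [hc]; linarith [show 0 ≤ ((i + k : ℕ) : ℝ) * h by positivity], hi⟩
    have hstep := BDF_step_iff.1 (hY.step i hi)
    have hd := hC h h0 i hi
    rw [← hc] at hd hstep
    rw [hy.derivWithin hT hcI] at hd
    rw [sum_smul_error, hstep]
    have e : h • f c (Y (i + k)) - ∑ j ∈ range (k + 1), (BDF k).α j • y (t₀ + ((i + j : ℕ) : ℝ) * h)
        = h • (f c (Y (i + k)) - f c (y c)) -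
          (∑ j ∈ range (k + 1), (BDF k).α j • y (t₀ + ((i + j : ℕ) : ℝ) * h) - h • f c (y c)) := by
      rw [smul_sub]; abel
    rw [e]
    refine (norm_sub_le _ _).trans (add_le_add ?_ hd)
    rw [norm_smul, Real.norm_eq_abs, abs_of_pos h0, mul_assoc]
    refine mul_le_mul_of_nonneg_left ((hL c _ _ (hY.mem _ hi) (hyK c hcI)).trans ?_) h0.le
    exact mul_le_mul_of_nonneg_right (le_max_left _ _) (norm_nonneg _)

/-- The leading term of the global error satisfies the linearized equation, driven by the leading
term of the defect. -/
theorem exists_leading_error [FiniteDimensional ℝ E] {k : ℕ} (hk : 1 ≤ k) (hT : t₀ < T)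
    (hy : IsODESolution f t₀ T y) (hDo : IsOpen D)
    (hf : ContDiffOn ℝ (k + 1 : ℕ) (fun x : ℝ × E => f x.1 x.2) D)
    (hD : ∀ t ∈ Set.Icc t₀ T, (t, y t) ∈ D) :
    ∃ e : ℝ → E, e t₀ = 0 ∧ ContDiffOn ℝ 2 e (Set.Icc t₀ T) ∧
      ∀ t ∈ Set.Icc t₀ T, HasDerivWithinAt e (stateDeriv f y t (e t) -
        BDFErrorConst k • iteratedDerivWithin (k + 1) y (Set.Icc t₀ T) t) (Set.Icc t₀ T) t := by
  have hyc := hy.contDiffOn hT hf hD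
  have hA := hy.contDiffOn_stateDeriv hT hDo
    (hf.of_le (by exact_mod_cast (by omega : 2 ≤ k + 1))) hD
  -- As `y` is `C^(k+2)`, `g` is `C^1` and `e` is `C^2`, which suffices for a defect of `e` of size
  -- `h^2`.
  set g : ℝ → E := fun t =>
    -(BDFErrorConst k • iteratedDerivWithin (k + 1) y (Set.Icc t₀ T) t) with hgdef
  have hg : ContDiffOn ℝ 1 g (Set.Icc t₀ T) := by
    refine ContDiffOn.neg (ContDiffOn.const_smul _ ?_)
    rw [show (1 : WithTop ℕ∞) = 0 + 1 from rfl,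
      contDiffOn_succ_iff_derivWithin (uniqueDiffOn_Icc hT)]
    refine ⟨hyc.differentiableOn_iteratedDerivWithin (by exact_mod_cast Nat.lt_succ_self _)
      (uniqueDiffOn_Icc hT), by simp, ?_⟩
    rw [contDiffOn_zero]
    have := hyc.continuousOn_iteratedDerivWithin le_rfl (uniqueDiffOn_Icc hT)
    rwa [iteratedDerivWithin_succ] at this
  obtain ⟨e, he0, he⟩ := exists_linear_ode_solution hT hA.continuousOn hg.continuousOn
  refine ⟨e, he0, ?_, fun t ht => by simpa only [hgdef, ← sub_eq_add_neg] using he t ht⟩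
  have hode : IsODESolution (fun t x => stateDeriv f y t x + g t) t₀ T e := he
  refine hode.contDiffOn hT (q := 1) (D := Set.Icc t₀ T ×ˢ Set.univ) ?_ fun t ht => ⟨ht, trivial⟩
  have hfst : Set.MapsTo Prod.fst (Set.Icc t₀ T ×ˢ (Set.univ : Set E)) (Set.Icc t₀ T) :=
    fun x hx => hx.1
  exact ((hA.comp contDiffOn_fst hfst).clm_apply contDiffOn_snd).add (hg.comp contDiffOn_fst hfst)

/-- The global error of the BDF method has an asymptotic expansion with leading term `h ^ k • e`. -/
theorem BDF_error_expansion [FiniteDimensional ℝ E] {k : ℕ} (hk : 1 ≤ k) (hk6 : k ≤ 6)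
    (hT : t₀ < T) (hy : IsODESolution f t₀ T y) (hDo : IsOpen D)
    (hf : ContDiffOn ℝ (k + 1 : ℕ) (fun x : ℝ × E => f x.1 x.2) D)
    (hD : ∀ t ∈ Set.Icc t₀ T, (t, y t) ∈ D)
    (hyK : ∀ t ∈ Set.Icc t₀ T, (t, y t) ∈ K) (hfK : LipschitzInState f K) :
    ∃ e : ℝ → E, ∀ M : ℝ, ∃ h₀ > (0 : ℝ), ∃ C : ℝ, ∀ h : ℝ, 0 < h → h < h₀ → ∀ Y : ℕ → E,
      (BDF k).IsNumericalSolution f t₀ T h K Y → StartWithin k y t₀ h (M * h ^ (k + 1)) Y →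
      ∀ n : ℕ, t₀ + (n : ℝ) * h ≤ T →
        ‖Y n - y (t₀ + (n : ℝ) * h) - h ^ k • e (t₀ + (n : ℝ) * h)‖ ≤ C * h ^ (k + 1) := by
  have hf2 : ContDiffOn ℝ 2 (fun x : ℝ × E => f x.1 x.2) D :=
    hf.of_le (by exact_mod_cast (by omega : 2 ≤ k + 1))
  have hyc := hy.contDiffOn hT hf hD
  obtain ⟨S, S0, hS⟩ := BDF_exists_zeroStableWith (E := E) hk hk6
  obtain ⟨e, he0, hec, he⟩ := exists_leading_error hk hT hy hDo hf hD
  obtain ⟨ρ, hρ, -, -, C₃, C₃0, hC₃⟩ := exists_tube_estimates hT hy hDo hf2 hD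
  obtain ⟨C₁, C₁0, hC₁⟩ := BDF_defect_expansion hk hk6 hT hyc
  obtain ⟨C₂, C₂0, hC₂⟩ := BDF_defect_le hk hk6 (m := 2) le_rfl (by omega) hT hec
  obtain ⟨A, hA⟩ := isCompact_Icc.exists_bound_of_continuousOn
    (hy.contDiffOn_stateDeriv hT hDo hf2 hD).continuousOn
  obtain ⟨Be, hBe⟩ := isCompact_Icc.exists_bound_of_continuousOn
    (hec.continuousOn_derivWithin (uniqueDiffOn_Icc hT) (by norm_num))
  have ht₀ : t₀ ∈ Set.Icc t₀ T := Set.left_mem_Icc.2 hT.le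
  have A0 : 0 ≤ A := (norm_nonneg _).trans (hA t₀ ht₀)
  have Be0 : 0 ≤ Be := (norm_nonneg _).trans (hBe t₀ ht₀)
  -- `e` is fixed before `M`: extrapolation uses two values of `M` and needs the same `e` for both.
  refine ⟨e, fun M => ?_⟩
  obtain ⟨h₁, hh₁, C₀, C₀0, hC₀⟩ := BDF_error_le hk hk6 hT hy
    (hyc.of_le (by exact_mod_cast (Nat.le_succ (k + 1)))) hyK hfK M
  have hkpos : (0 : ℝ) < k := by exact_mod_cast hk
  have hTpos : 0 < T - t₀ := by linarith
  -- Besides `h < 1`, the bounds on `h` serve the Gronwall condition, `BDF_error_le`, starting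
  -- points inside `[t₀, T]`, and numerical points inside the tube of the quadratic estimate, which
  -- is unrelated to `K`.
  refine ⟨min (min 1 (1 / (2 * (S * A + 1)))) (min h₁ (min ((T - t₀) / k) (ρ / (C₀ + 1)))),
    by positivity,
    2 * S * ((M + k * Be) + (T - t₀) * (C₃ * C₀ ^ 2 + C₁ + C₂)) *
      Real.exp (2 * S * ((T - t₀) * A)), ?_⟩
  intro h h0 hh Y hY hstart n hn
  simp only [lt_min_iff] at hh
  obtain ⟨⟨h1, h2⟩, h3, h4, h5⟩ := hh
  rw [lt_div_iff₀ (by positivity)] at h2 h4 h5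
  refine hS.norm_le_of_grid hk S0
    (w := fun n => Y n - y (t₀ + (n : ℝ) * h) - h ^ k • e (t₀ + (n : ℝ) * h)) h0 A0
    (by positivity) (by linarith) ?_ ?_ hn
  · intro j hj
    have hjk : (j : ℝ) ≤ k := by exact_mod_cast hj.le
    have hj0 : 0 ≤ (j : ℝ) * h := by positivity
    have htj : t₀ + (j : ℝ) * h ∈ Set.Icc t₀ T := ⟨by linarith, by nlinarith⟩
    -- Because `e t₀ = 0`, the term `h^k e` is itself `O(h^(k+1))` at the starting points.
    have hej : ‖e (t₀ + (j : ℝ) * h)‖ ≤ Be * (k * h) := by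
      have := (convex_Icc t₀ T).norm_image_sub_le_of_norm_derivWithin_le
        (fun t ht => (he t ht).differentiableWithinAt) hBe ht₀ htj
      rw [he0, sub_zero, add_sub_cancel_left, Real.norm_eq_abs, abs_of_nonneg hj0] at this
      exact this.trans (by gcongr)
    refine (norm_sub_le _ _).trans ((add_le_add (hstart j hj) (norm_smul_le _ _)).trans ?_)
    rw [Real.norm_eq_abs, abs_of_pos (by positivity)]
    have := mul_le_mul_of_nonneg_left hej (pow_nonneg h0.le k)
    rw [pow_succ] at *
    linarith
  · intro i hi
    set c := t₀ + ((i + k : ℕ) : ℝ) * h with hc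
    have hcI : c ∈ Set.Icc t₀ T :=
      ⟨by rw [hc]; linarith [show 0 ≤ ((i + k : ℕ) : ℝ) * h by positivity], hi⟩
    have hstep := BDF_step_iff.1 (hY.step i hi)
    have hd₁ := hC₁ h h0 i hi
    have hd₂ := hC₂ h h0 i hi
    have hd₀ := hC₀ h h0 h3 Y hY hstart (i + k) hi
    rw [← hc] at hstep hd₁ hd₂ hd₀
    rw [hy.derivWithin hT hcI] at hd₁
    rw [(he c hcI).derivWithin (uniqueDiffOn_Icc hT c hcI)] at hd₂
    have hhk : h ^ k ≤ h := pow_le_of_le_one h0.le h1.le (by omega)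
    have htube : (c, Y (i + k)) ∈ tube y t₀ T ρ := by
      refine ⟨hcI, hd₀.trans ?_⟩
      nlinarith [mul_le_mul_of_nonneg_left hhk C₀0]
    have hR := hC₃ c _ htube
    set sy := ∑ j ∈ range (k + 1), (BDF k).α j • y (t₀ + ((i + j : ℕ) : ℝ) * h)
    set se := ∑ j ∈ range (k + 1), (BDF k).α j • e (t₀ + ((i + j : ℕ) : ℝ) * h) with hse
    set z := iteratedDerivWithin (k + 1) y (Set.Icc t₀ T) c
    set B := stateDeriv f y c
    set R := f c (Y (i + k)) - f c (y c) - B (Y (i + k) - y c) with hRdef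
    -- The error-constant term occurs in the defect of `y` and, times `h^k`, in the equation for
    -- `e`; the two copies cancel.
    have hsum : ∑ j ∈ range (k + 1), (BDF k).α j • (Y (i + j) -
          y (t₀ + ((i + j : ℕ) : ℝ) * h) - h ^ k • e (t₀ + ((i + j : ℕ) : ℝ) * h)) =
        h • B (Y (i + k) - y c - h ^ k • e c) + h • R -
          (sy - h • f c (y c) - (h ^ (k + 1) * BDFErrorConst k) • z) -
          h ^ k • (se - h • (B (e c) - BDFErrorConst k • z)) := by
      have : ∑ j ∈ range (k + 1), (BDF k).α j • (Y (i + j) -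
          y (t₀ + ((i + j : ℕ) : ℝ) * h) - h ^ k • e (t₀ + ((i + j : ℕ) : ℝ) * h)) =
          h • f c (Y (i + k)) - sy - h ^ k • se := by
        rw [← hstep, hse, smul_sum, ← sum_sub_distrib, ← sum_sub_distrib]
        refine sum_congr rfl fun j _ => ?_
        module
      rw [this, hRdef, map_sub B _ (h ^ k • e c), map_smul]
      module
    rw [hsum]
    have hRle : ‖R‖ ≤ C₃ * C₀ ^ 2 * h ^ (k + 1) := by
      refine hR.trans ?_
      calc C₃ * ‖Y (i + k) - y c‖ ^ 2 ≤ C₃ * (C₀ * h ^ k) ^ 2 := by gcongr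
        _ = C₃ * C₀ ^ 2 * (h ^ k * h ^ k) := by ring
        _ ≤ C₃ * C₀ ^ 2 * (h ^ k * h) := by gcongr
        _ = _ := by ring
    have hBle := (B.le_opNorm (Y (i + k) - y c - h ^ k • e c)).trans
      (mul_le_mul_of_nonneg_right (hA c hcI) (norm_nonneg _))
    refine (norm_sub_le _ _).trans ((add_le_add ((norm_sub_le _ _).trans
      (add_le_add (norm_add_le _ _) hd₁)) le_rfl).trans ?_)
    rw [norm_smul, norm_smul, norm_smul, Real.norm_eq_abs, Real.norm_eq_abs, abs_of_pos h0,
      abs_of_pos (pow_pos h0 k)]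
    calc _ ≤ h * (A * ‖Y (i + k) - y c - h ^ k • e c‖) + h * (C₃ * C₀ ^ 2 * h ^ (k + 1)) +
          C₁ * h ^ (k + 2) + h ^ k * (C₂ * h ^ 2) := by gcongr
      _ = _ := by ring

/-- The global Richardson extrapolation of the `k`-step BDF method has error `O(h ^ (k + 1))`. -/
theorem BDF_greError [FiniteDimensional ℝ E] {k : ℕ} (hk : 1 ≤ k) (hk6 : k ≤ 6)
    (hT : t₀ < T) (hy : IsODESolution f t₀ T y) (hDo : IsOpen D)
    (hf : ContDiffOn ℝ (k + 1 : ℕ) (fun x : ℝ × E => f x.1 x.2) D)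
    (hD : ∀ t ∈ Set.Icc t₀ T, (t, y t) ∈ D) :
    (BDF k).GREError k (k + 1) f D t₀ T y := by
  intro K _ hyK hfK M
  obtain ⟨e, he⟩ := BDF_error_expansion hk hk6 hT hy hDo hf hD hyK hfK
  obtain ⟨h₁, hh₁, C₁, hC₁⟩ := he M
  -- In terms of the fine step, `M h^(k+1) = M 2^(k+1) (h/2)^(k+1)`.
  obtain ⟨h₂, hh₂, C₂, hC₂⟩ := he (M * 2 ^ (k + 1))
  set a : ℝ := 2 ^ k / (2 ^ k - 1)
  set b : ℝ := 1 / (2 ^ k - 1)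
  have h2k : (0 : ℝ) < 2 ^ k - 1 := sub_pos.2 (one_lt_pow₀ one_lt_two (by omega))
  have ha0 : 0 ≤ a := by positivity
  have hb0 : 0 ≤ b := by positivity
  refine ⟨min h₁ h₂, lt_min hh₁ hh₂, a * (C₂ * (1 / 2) ^ (k + 1)) + b * C₁, ?_⟩
  intro h h0 hh Y Z hY hYs hZ hZs n hn
  have hYn := hC₁ h h0 (hh.trans_le (min_le_left _ _)) Y hY hYs n hn
  have hgrid : t₀ + ((2 * n : ℕ) : ℝ) * (h / 2) = t₀ + (n : ℝ) * h := by push_cast; ring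
  have hZn := hC₂ (h / 2) (by linarith) (by linarith [hh.trans_le (min_le_right _ _)]) Z hZ
    (fun j hj => (hZs j hj).trans (le_of_eq (by rw [div_pow]; field_simp))) (2 * n)
    (by rw [hgrid]; exact hn)
  rw [hgrid] at hZn
  set c := t₀ + (n : ℝ) * h
  have hab : a - b = 1 := by
    rw [div_sub_div_same, div_self h2k.ne']
  have hab2 : a * (h / 2) ^ k = b * h ^ k := by
    simp only [a, b, div_pow]; field_simp
  have key : greSeq k Y Z n - y c = a • (Z (2 * n) - y c - (h / 2) ^ k • e c) -
      b • (Y n - y c - h ^ k • e c) := by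
    have h1 : a • (Z (2 * n) - y c - (h / 2) ^ k • e c) - b • (Y n - y c - h ^ k • e c) =
        a • Z (2 * n) - b • Y n - (a - b) • y c - (a * (h / 2) ^ k - b * h ^ k) • e c := by
      module
    rw [h1, hab, hab2, sub_self, zero_smul, one_smul, sub_zero]
    rfl
  rw [key]
  refine (norm_sub_le _ _).trans ?_
  rw [norm_smul, norm_smul, Real.norm_eq_abs, Real.norm_eq_abs, abs_of_nonneg ha0,
    abs_of_nonneg hb0]
  calc _ ≤ a * (C₂ * (h / 2) ^ (k + 1)) + b * (C₁ * h ^ (k + 1)) := by gcongr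
    _ = _ := by rw [div_eq_mul_one_div h, mul_pow]; ring

end Convergence

/-! ### Local existence and uniqueness of the BDF sequence. -/

section WellPosedness

open scoped NNReal

variable {E : Type*} [NormedAddCommGroup E] [NormedSpace ℝ E]

/-- The equation of an implicit step is uniquely solvable for small step sizes. -/
theorem existsUnique_implicit_step [CompleteSpace E] {g : E → E} {K : ℝ≥0} (hg : LipschitzWith K g)
    {a h : ℝ} (h0 : 0 ≤ h) (hK : h * K < a) (r : E) : ∃! u : E, a • u = r + h • g u := by
  have a0 : 0 < a := lt_of_le_of_lt (by positivity) hK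
  have hc : ContractingWith (a⁻¹ * (h * K)).toNNReal fun u => a⁻¹ • (r + h • g u) := by
    constructor
    · rw [Real.toNNReal_lt_one, inv_mul_lt_one₀ a0]
      exact hK
    · refine LipschitzWith.of_dist_le_mul fun u v => ?_
      rw [Real.coe_toNNReal _ (by positivity), dist_smul₀, dist_add_left, dist_smul₀,
        Real.norm_eq_abs, Real.norm_eq_abs, abs_of_nonneg h0, abs_of_pos (inv_pos.2 a0), mul_assoc,
        mul_assoc]
      gcongr
      exact hg.dist_le_mul u v
  have hiff : ∀ u, a • u = r + h • g u ↔ Function.IsFixedPt (fun u => a⁻¹ • (r + h • g u)) u :=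
    fun u => by
      rw [Function.IsFixedPt, inv_smul_eq_iff₀ a0.ne']
      exact eq_comm
  exact ⟨hc.fixedPoint, (hiff _).2 hc.fixedPoint_isFixedPt,
    fun u hu => hc.fixedPoint_unique ((hiff u).1 hu)⟩

variable {f g : ℝ → E → E} {D : Set (ℝ × E)} {t₀ T : ℝ} {y : ℝ → E}

theorem BDF_step_iff_leading {k : ℕ} {h : ℝ} {Y : ℕ → E} {n : ℕ} :
    (BDF k).Step f t₀ h Y n ↔ (BDF k).α k • Y (n + k) =
      -(∑ j ∈ range k, (BDF k).α j • Y (n + j)) +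
        h • f (t₀ + ((n + k : ℕ) : ℝ) * h) (Y (n + k)) := by
  rw [BDF_step_iff, sum_range_succ, eq_neg_add_iff_add_eq]

/-- For a globally Lipschitz right-hand side any number of steps can be performed. -/
theorem BDF_exists_steps [CompleteSpace E] {k : ℕ} {K : ℝ≥0} (hg : ∀ t, LipschitzWith K (g t))
    {h : ℝ} (h0 : 0 ≤ h) (hK : h * K < (BDF k).α k) (s : ℕ → E) (N : ℕ) :
    ∃ Y : ℕ → E, (∀ j < k, Y j = s j) ∧ ∀ n < N, (BDF k).Step g t₀ h Y n := by
  induction N with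
  | zero => exact ⟨s, fun _ _ => rfl, fun n hn => absurd hn (Nat.not_lt_zero n)⟩
  | succ N ih =>
    obtain ⟨Y, hYs, hY⟩ := ih
    obtain ⟨u, hu, -⟩ := existsUnique_implicit_step (hg (t₀ + ((N + k : ℕ) : ℝ) * h)) h0 hK
      (-(∑ j ∈ range k, (BDF k).α j • Y (N + j)))
    have hne : ∀ m, m < N + k → Function.update Y (N + k) u m = Y m := fun m hm =>
      Function.update_of_ne hm.ne _ _
    refine ⟨Function.update Y (N + k) u, fun j hj => (hne j (by omega)).trans (hYs j hj),
      fun n hn => ?_⟩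
    have hsum : ∑ j ∈ range k, (BDF k).α j • Function.update Y (N + k) u (n + j) =
        ∑ j ∈ range k, (BDF k).α j • Y (n + j) :=
      sum_congr rfl fun j hj => by
        have := mem_range.1 hj
        rw [hne _ (by omega)]
    rw [BDF_step_iff_leading, hsum]
    rcases Nat.lt_succ_iff_lt_or_eq.1 hn with hlt | rfl
    · rw [hne _ (by omega)]
      exact BDF_step_iff_leading.1 (hY n hlt)
    · rw [Function.update_self]
      exact hu

/-- For a globally Lipschitz right-hand side the numerical solution is determined by its starting
values. -/
theorem BDF_steps_unique [CompleteSpace E] {k : ℕ} {K : ℝ≥0} (hg : ∀ t, LipschitzWith K (g t))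
    {h : ℝ} (h0 : 0 ≤ h) (hK : h * K < (BDF k).α k) {Y Y' : ℕ → E} (hs : ∀ j < k, Y j = Y' j)
    (hY : ∀ n : ℕ, t₀ + ((n + k : ℕ) : ℝ) * h ≤ T → (BDF k).Step g t₀ h Y n)
    (hY' : ∀ n : ℕ, t₀ + ((n + k : ℕ) : ℝ) * h ≤ T → (BDF k).Step g t₀ h Y' n) :
    ∀ n : ℕ, t₀ + (n : ℝ) * h ≤ T → Y n = Y' n := by
  intro n
  induction n using Nat.strong_induction_on with
  | _ n ih =>
    intro hn
    by_cases hnk : n < k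
    · exact hs n hnk
    obtain ⟨i, rfl⟩ : ∃ i, n = i + k := ⟨n - k, by omega⟩
    have hsum : ∑ j ∈ range k, (BDF k).α j • Y (i + j) =
        ∑ j ∈ range k, (BDF k).α j • Y' (i + j) :=
      sum_congr rfl fun j hj => by
        have hj := mem_range.1 hj
        have hle : ((i + j : ℕ) : ℝ) ≤ ((i + k : ℕ) : ℝ) := by exact_mod_cast (by omega)
        rw [ih (i + j) (by omega) ((add_le_add_right (mul_le_mul_of_nonneg_right hle h0) _).trans hn)]
    have h1 := BDF_step_iff_leading.1 (hY i hn)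
    have h2 := BDF_step_iff_leading.1 (hY' i hn)
    rw [hsum] at h1
    exact (existsUnique_implicit_step (hg _) h0 hK _).unique h1 h2

/-- A right-hand side that is Lipschitz in the state on a tube extends to a globally Lipschitz
one. -/
theorem exists_lipschitz_extension_of_tube [FiniteDimensional ℝ E] {ρ : ℝ}
    (hf : LipschitzInState f (tube y t₀ T ρ)) :
    ∃ (g : ℝ → E → E) (K : ℝ≥0), (∀ t, LipschitzWith K (g t)) ∧
      ∀ (t : ℝ) (u : E), (t, u) ∈ tube y t₀ T ρ → g t u = f t u := by
  obtain ⟨L, hL⟩ := hf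
  -- The extension is chosen separately for each `t`; continuity in `t` plays no role for the
  -- discrete recursion.
  have : ∀ t, ∃ g : E → E, LipschitzWith (lipschitzExtensionConstant E * L.toNNReal) g ∧
      Set.EqOn (f t) g {u | (t, u) ∈ tube y t₀ T ρ} := fun t =>
    LipschitzOnWith.extend_finite_dimension (LipschitzOnWith.of_dist_le_mul fun u hu v hv => by
      rw [dist_eq_norm, dist_eq_norm]
      exact (hL t u v hu hv).trans
        (mul_le_mul_of_nonneg_right (Real.le_coe_toNNReal L) (norm_nonneg _)))
  choose g hg hfg using this
  exact ⟨g, _, hg, fun t u hu => (hfg t hu).symm⟩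

/-- The BDF method is locally well-posed. -/
theorem BDF_wellPosedNear [FiniteDimensional ℝ E] {k : ℕ} (hk : 1 ≤ k) (hk6 : k ≤ 6)
    (hT : t₀ < T) (hy : IsODESolution f t₀ T y) (hDo : IsOpen D)
    (hf : ContDiffOn ℝ (k + 1 : ℕ) (fun x : ℝ × E => f x.1 x.2) D)
    (hD : ∀ t ∈ Set.Icc t₀ T, (t, y t) ∈ D) :
    (BDF k).WellPosedNear (k + 1) f D t₀ T y := by
  have : CompleteSpace E := FiniteDimensional.complete ℝ E
  obtain ⟨ρ, hρ, hsub, ⟨L, -, hL⟩, -⟩ := exists_tube_estimates hT hy hDo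
    (hf.of_le (by exact_mod_cast (by omega : 2 ≤ k + 1))) hD
  have hLip : LipschitzInState f (tube y t₀ T ρ) := ⟨L, hL⟩
  -- The sequence for `g` exists, and its error `O(h^k)` keeps it in the tube, where `g = f`.
  -- Conversely every sequence for `f` in the tube is one for `g`, whence uniqueness.
  obtain ⟨g, K, hg, hgf⟩ := exists_lipschitz_extension_of_tube hLip
  refine ⟨ρ, hρ, hsub, hLip, fun M => ?_⟩
  have hyg : IsODESolution g t₀ T y := fun t ht => by
    rw [hgf t (y t) ⟨ht, by simpa using hρ.le⟩]
    exact hy t ht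
  obtain ⟨h₁, hh₁, C, C0, hC⟩ := BDF_error_le (K := Set.univ) hk hk6 hT hyg
    ((hy.contDiffOn hT hf hD).of_le (by exact_mod_cast (Nat.le_succ (k + 1))))
    (fun _ _ => trivial) ⟨K, fun t u v _ _ => by
      simpa only [dist_eq_norm] using (hg t).dist_le_mul u v⟩ M
  have hα := BDF_leading_pos k hk
  change 0 < (BDF k).α k at hα
  refine ⟨min (min 1 h₁) (min (ρ / (C + 1)) ((BDF k).α k / (K + 1))), by positivity, ?_⟩
  intro h h0 hh s hs
  simp only [lt_min_iff] at hh
  obtain ⟨⟨h1, h2⟩, h3, h4⟩ := hh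
  rw [lt_div_iff₀ (by positivity)] at h3 h4
  have hK : h * K < (BDF k).α k := by linarith
  have htube : ∀ Y : ℕ → E, (BDF k).IsNumericalSolution f t₀ T h (tube y t₀ T ρ) Y →
      ∀ n : ℕ, t₀ + ((n + k : ℕ) : ℝ) * h ≤ T → (BDF k).Step g t₀ h Y n := fun Y hY n hn => by
    rw [BDF_step_iff, hgf _ _ (hY.mem _ hn)]
    exact BDF_step_iff.1 (hY.step n hn)
  constructor
  · obtain ⟨N, hN⟩ := exists_nat_gt ((T - t₀) / h)
    rw [div_lt_iff₀ h0] at hN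
    obtain ⟨Y, hYs, hY⟩ := BDF_exists_steps (t₀ := t₀) hg h0.le hK s N
    have hstep : ∀ n : ℕ, t₀ + ((n + k : ℕ) : ℝ) * h ≤ T → (BDF k).Step g t₀ h Y n := by
      intro n hn
      refine hY n ?_
      by_contra hnN
      have : (N : ℝ) ≤ ((n + k : ℕ) : ℝ) := by exact_mod_cast (by omega)
      nlinarith
    have hmem : ∀ n : ℕ, t₀ + (n : ℝ) * h ≤ T → (t₀ + (n : ℝ) * h, Y n) ∈ tube y t₀ T ρ := by
      intro n hn
      refine ⟨⟨by linarith [show 0 ≤ (n : ℝ) * h by positivity], hn⟩, ?_⟩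
      refine (hC h h0 h2 Y ⟨hstep, fun _ _ => trivial⟩
        (fun j hj => by rw [hYs j hj]; exact hs j hj) n hn).trans ?_
      have hhk : h ^ k ≤ h := pow_le_of_le_one h0.le h1.le (by omega)
      nlinarith [mul_le_mul_of_nonneg_left hhk C0]
    refine ⟨Y, ⟨fun n hn => ?_, hmem⟩, hYs⟩
    have := BDF_step_iff.1 (hstep n hn)
    rw [hgf _ _ (hmem (n + k) hn)] at this
    exact BDF_step_iff.2 this
  · intro Y Y' hY hYs hY' hYs'
    exact BDF_steps_unique hg h0.le hK (fun j hj => (hYs j hj).trans (hYs' j hj).symm)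
      (htube Y hY) (htube Y' hY')

/-- The global Richardson extrapolation of the `k`-step BDF method converges with order `k + 1`. -/
theorem BDF_greConvergesWithOrder {k : ℕ} (hk : 1 ≤ k) (hk6 : k ≤ 6) :
    (BDF k).GREConvergesWithOrder k (k + 1) :=
  fun _ _ _ _ _ _ hT hDo hf hy hD =>
    ⟨BDF_wellPosedNear hk hk6 hT hy hDo hf hD, BDF_greError hk hk6 hT hy hDo hf hD⟩

end WellPosedness

/-! ### Stability regions. -/

section Stability

/-- The stability region of the extrapolated method is contained in that of the method itself. -/
theorem LMM.greStabilityRegion_subset (m : LMM) {p : ℕ} (hp : 1 ≤ p) :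
    m.greStabilityRegion p ⊆ m.stabilityRegion := by
  rintro μ ⟨hμ, -, h⟩
  refine ⟨hμ, fun Y hY => ?_⟩
  obtain ⟨C, hC⟩ := h Y 0 hY (fun n => by simp)
  have hpos : (0 : ℝ) < 2 ^ p - 1 := sub_pos.2 (one_lt_pow₀ one_lt_two (by omega))
  refine ⟨(2 ^ p - 1) * C, fun n => ?_⟩
  have := hC n
  rw [greSeq, Pi.zero_apply, smul_zero, zero_sub, norm_neg, norm_smul, Real.norm_eq_abs,
    abs_of_pos (by positivity), one_div, inv_mul_le_iff₀ hpos] at this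
  exact this

/-- The extrapolated method is stable at `μ` if the method is stable at `μ` and at `μ / 2`. -/
theorem LMM.mem_greStabilityRegion {m : LMM} {p : ℕ} {μ : ℂ} (h₁ : μ ∈ m.stabilityRegion)
    (h₂ : μ / 2 ∈ m.stabilityRegion) : μ ∈ m.greStabilityRegion p := by
  refine ⟨h₁.1, h₂.1, fun Y Z hY hZ => ?_⟩
  obtain ⟨C₁, hC₁⟩ := h₁.2 Y hY
  obtain ⟨C₂, hC₂⟩ := h₂.2 Z hZ
  refine ⟨‖(2 : ℝ) ^ p / ((2 : ℝ) ^ p - 1)‖ * C₂ + ‖1 / ((2 : ℝ) ^ p - 1)‖ * C₁, fun n => ?_⟩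
  refine (norm_sub_le _ _).trans ?_
  rw [norm_smul, norm_smul]
  gcongr
  · exact hC₂ _
  · exact hC₁ _

/-- Extrapolation does not change `A(θ)`-stability. -/
theorem LMM.isAThetaStable_gre_iff (m : LMM) {p : ℕ} (hp : 1 ≤ p) (θ : ℝ) :
    IsAThetaStable (m.greStabilityRegion p) θ ↔ IsAThetaStable m.stabilityRegion θ := by
  refine ⟨fun h => h.trans (m.greStabilityRegion_subset hp), fun h μ hμ => ?_⟩
  -- The sector is a cone, so it contains `μ / 2`.
  refine LMM.mem_greStabilityRegion (h hμ) (h ⟨div_ne_zero hμ.1 two_ne_zero, ?_⟩)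
  have : -(μ / 2) = ((1 / 2 : ℝ) : ℂ) * -μ := by push_cast; ring
  rw [this, Complex.arg_real_mul _ (by norm_num)]
  exact hμ.2

/-- The two-step BDF method is `A`-stable. -/
theorem BDF_two_isAStable : IsAStable (BDF 2).stabilityRegion := by
  intro μ hμ
  have hμ : μ.re ≤ 0 := hμ
  have hα : (BDF 2).k = 2 ∧ (BDF 2).α 0 = 1 / 2 ∧ (BDF 2).α 1 = -2 ∧ (BDF 2).α 2 = 3 / 2 ∧
      (BDF 2).β 0 = 0 ∧ (BDF 2).β 1 = 0 ∧ (BDF 2).β 2 = 1 := by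
    norm_num [BDF, sum_Icc_succ_top, Nat.choose]
  obtain ⟨hk, hα0, hα1, hα2, hβ0, hβ1, hβ2⟩ := hα
  refine ⟨fun h => ?_, fun Y hY => ?_⟩
  · have := congrArg Complex.re h
    rw [hk, hα2, hβ2] at this
    norm_num at this
    linarith
  have hrec : ∀ n, 1 / 2 * Y n - 2 * Y (n + 1) + 3 / 2 * Y (n + 2) = μ * Y (n + 2) := by
    intro n
    have := hY n
    rw [hk] at this
    simp only [sum_range_succ, sum_range_zero, hα0, hα1, hα2, hβ0, hβ1, hβ2] at this
    push_cast at this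
    linear_combination this
  -- `V` is the G-norm of BDF2. With `a, b, c` for `Y (n + 2), Y (n + 1), Y n`, the identity `4 Re
  -- (conj a * (3/2 a - 2 b + 1/2 c)) = V (n + 1) - V n + |a - 2 b + c|²` holds, and by the
  -- recursion the left side is `4 Re μ |a|² ≤ 0`.
  set V : ℕ → ℝ := fun n => Complex.normSq (Y (n + 1)) + Complex.normSq (2 * Y (n + 1) - Y n) with hV
  have hstep : ∀ n, V (n + 1) ≤ V n := by
    intro n
    have h1 := congrArg Complex.re (hrec n)
    have h2 := congrArg Complex.im (hrec n)
    simp only [hV, Complex.normSq_apply]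
    simp at h1 h2 ⊢
    nlinarith [mul_nonneg (neg_nonneg.2 hμ) (add_nonneg (sq_nonneg (Y (n + 2)).re)
      (sq_nonneg (Y (n + 2)).im)), sq_nonneg ((Y (n + 2)).re - 2 * (Y (n + 1)).re + (Y n).re),
      sq_nonneg ((Y (n + 2)).im - 2 * (Y (n + 1)).im + (Y n).im),
      congrArg (· * (Y (n + 2)).re) h1, congrArg (· * (Y (n + 2)).im) h2]
  have hle : ∀ n, V n ≤ V 0 := fun n => antitone_nat_of_succ_le hstep (Nat.zero_le n)
  refine ⟨max ‖Y 0‖ √(V 0), fun n => ?_⟩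
  rcases n with _ | n
  · exact le_max_left _ _
  · refine le_trans (Real.le_sqrt_of_sq_le ?_) (le_max_right _ _)
    rw [Complex.sq_norm]
    have := hle n
    have h0 := Complex.normSq_nonneg (2 * Y (n + 1) - Y n)
    simp only [hV] at this ⊢
    linarith

end Stability

theorem mainTheorem4 :
    (∀ k : ℕ, 1 ≤ k → k ≤ 6 →
      (BDF k).GREConvergesWithOrder k (k + 1) ∧
      (∀ θ : ℝ, 0 < θ → θ ≤ Real.pi / 2 →
        (IsAThetaStable ((BDF k).greStabilityRegion k) θ ↔
          IsAThetaStable (BDF k).stabilityRegion θ)) ∧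
      stabilityAngle ((BDF k).greStabilityRegion k) = stabilityAngle (BDF k).stabilityRegion) ∧
    (BDF 2).GREConvergesWithOrder 2 3 ∧
    IsAStable ((BDF 2).greStabilityRegion 2) := by
  refine ⟨fun k hk hk6 => ⟨BDF_greConvergesWithOrder hk hk6,
    fun θ _ _ => (BDF k).isAThetaStable_gre_iff hk θ, ?_⟩,
    BDF_greConvergesWithOrder one_le_two (by norm_num), fun μ hμ => ?_⟩
  · simp only [stabilityAngle, (BDF k).isAThetaStable_gre_iff hk]
  · refine LMM.mem_greStabilityRegion (BDF_two_isAStable hμ) (BDF_two_isAStable ?_)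
    have hμ : μ.re ≤ 0 := hμ
    have : (μ / 2).re = μ.re / 2 := by simp
    show (μ / 2).re ≤ 0
    linarith
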